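/- Let $\mu>0$ and $\lambda>-\tfrac{2\mu}{3}$ be the Lamé parameters, $\alpha=\frac{\mu+\lambda}{2}$, $\beta=\frac{3\mu+\lambda}{2}$, and let $\alpha^*=\frac{\alpha}{\alpha^2-\beta^2}$, $\beta^*=\frac{\beta}{\alpha^2-\beta^2}$. With $\partial_z=\frac12(\partial_x-i\partial_y)$ and $\partial_{\bar z}=\frac12(\partial_x+i\partial_y)$ put $$\mathcal L_{\alpha,\beta}[f]=\alpha\,\partial_{\bar z}\partial_{\bar z}\overline{f}+\beta\,\partial_{\bar z}\partial_z f .$$ Let $\Omega\subset\mathbb C$ be a bounded open set (in particular, $\Omega$ may be the interior of a smooth closed Jordan curve $\gamma$), $\Omega_-=\mathbb C\setminus\overline\Omega$, and $g\in C(\overline\Omega)$, complex valued. For $z\in\mathbb C$ define $$\mathcal T[g](z)=\frac1\pi\int_\Omega\Big[\alpha^*\frac{\xi-z}{\overline{\xi-z}}\,\overline{g(\xi)}-\beta^*\ln|\xi-z|^2\,g(\xi)\Big]\,d\xi ,$$ where $d\xi$ is area measure. Then the integrand is integrable for every $z$, $\mathcal T[g]\in C^1(\mathbb C)$, and: 1.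 $\mathcal L_{\alpha,\beta}\mathcal T[g]=g$ in $\Omega$ in the sense of generalized (distributional) derivatives: for every $\varphi\in C_c^\infty(\Omega;\mathbb C)$, $$\int_\Omega\big(\alpha\,\overline{\mathcal T[g]}\;\partial_{\bar z}\partial_{\bar z}\varphi+\beta\,\mathcal T[g]\;\partial_{\bar z}\partial_z\varphi\big)\,dz=\int_\Omega g\,\varphi\,dz .$$ Moreover $\mathcal L_{\alpha,\beta}\mathcal T[g](z)=g(z)$ holds classically at every point $z\in\Omega$ at which $\partial_{\bar z}\overline{\mathcal T[g]}$ and $\partial_z\mathcal T[g]$ are (real) differentiable. 2. $\mathcal T[g]$ is $C^\infty$ in $\Omega_-$, and $\mathcal L_{\alpha,\beta}\mathcal T[g](z)=0$ classically for every $z\in\Omega_-$. -/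

import Mathlib

open MeasureTheory Set
open scoped ComplexConjugate ContDiff

noncomputable section

namespace LameNavier

/-- The Wirtinger derivative `∂_z f = (∂_x f - i ∂_y f) / 2`. -/
def dz (f : ℂ → ℂ) (z : ℂ) : ℂ :=
  (1 / 2 : ℂ) * (fderiv ℝ f z 1 - Complex.I * fderiv ℝ f z Complex.I)

/-- The Cauchy-Riemann operator `∂_{z̄} f = (∂_x f + i ∂_y f) / 2`. -/
def dzbar (f : ℂ → ℂ) (z : ℂ) : ℂ :=
  (1 / 2 : ℂ) * (fderiv ℝ f z 1 + Complex.I * fderiv ℝ f z Complex.I)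

/-- `α = (μ + λ) / 2` in terms of the Lamé parameters. -/
def lameAlpha (lam mu : ℝ) : ℝ := (mu + lam) / 2

/-- `β = (3 μ + λ) / 2` in terms of the Lamé parameters. -/
def lameBeta (lam mu : ℝ) : ℝ := (3 * mu + lam) / 2

/-- `α* = α / (α² - β²)`. -/
def alphaStar (α β : ℝ) : ℝ := α / (α ^ 2 - β ^ 2)

/-- `β* = β / (α² - β²)`. -/
def betaStar (α β : ℝ) : ℝ := β / (α ^ 2 - β ^ 2)

/-- The classical operator `L_{α,β}[f] = α ∂_{z̄} ∂_{z̄} f̄ + β ∂_{z̄} ∂_z f`. -/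
def lameOp (α β : ℝ) (f : ℂ → ℂ) (z : ℂ) : ℂ :=
  (α : ℂ) * dzbar (dzbar (fun w => conj (f w))) z + (β : ℂ) * dzbar (dz f) z

/-- `L_{α,β}[f] = h` in the open set `U` in the sense of distributions (generalized derivatives).
Moving two first-order derivatives onto the test function produces no sign. -/
def LameOpEqWeak (α β : ℝ) (U : Set ℂ) (f h : ℂ → ℂ) : Prop :=
  LocallyIntegrableOn f U ∧ LocallyIntegrableOn h U ∧
    ∀ φ : ℂ → ℂ, ContDiff ℝ ∞ φ → HasCompactSupport φ → tsupport φ ⊆ U →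
      ∫ z in U, ((α : ℂ) * conj (f z) * dzbar (dzbar φ) z + (β : ℂ) * f z * dzbar (dz φ) z)
        = ∫ z in U, h z * φ z

/-- The integrand `α* (ξ - z) / conj (ξ - z) · conj (g ξ) - β* ln |ξ - z|² · g ξ`. -/
def teodorescuIntegrand (α β : ℝ) (g : ℂ → ℂ) (z ξ : ℂ) : ℂ :=
  (alphaStar α β : ℂ) * ((ξ - z) / conj (ξ - z)) * conj (g ξ)
    - (betaStar α β : ℂ) * (Real.log (‖ξ - z‖ ^ 2) : ℂ) * g ξ

/-- The Teodorescu type operator; the integral is with respect to area measure. -/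
def teodorescu (α β : ℝ) (Ω : Set ℂ) (g : ℂ → ℂ) (z : ℂ) : ℂ :=
  (1 / (Real.pi : ℂ)) * ∫ ξ in Ω, teodorescuIntegrand α β g z ξ

end LameNavier

end

/-!
The first derivatives of `𝒯[g]` are convolutions of `g` and its conjugate with kernels of size
`1 / |w|`, and the constants `α*`, `β*` are chosen so that in
`F = α ∂_{z̄} (conj 𝒯[g]) + β ∂_z 𝒯[g]` the terms containing the conjugate of `g` cancel. What is
left is the Cauchy transform `F(z) = (1/π) ∫_Ω g(ξ) / (z - ξ) dξ`
(`lame_first_order_teodorescu`), and `L_{α,β} 𝒯[g] = ∂_{z̄} F`; so everything reduces to the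
equation `∂_{z̄} F = g`, where `g` is extended by zero outside `Ω`.

* Regularity. The kernels `w / w̄` and `log |w|²` are limits of the smooth kernels
  `w² / (|w|² + δ)` and `log (|w|² + δ)`, and their first derivatives converge as well, all
  dominated by a locally integrable function. Hence the regularized potentials converge uniformly on balls
  together with their derivatives (`BoundedDensity.hasFDerivAt_potential`), so `𝒯[g]` is `C¹`.
  Away from the closure of `Ω` the singularity of the kernels can be cut off, and convolution with
  a smooth compactly supported kernel is smooth (`BoundedDensity.contDiffAt_potential`).
* The weak equation. The Cauchy-Pompeiu formula for test functions (`integral_inv_sub_mul_dzbar`)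
  follows from an integration by parts against `w̄ / (|w|² + δ)`, whose `∂_{z̄}` derivative
  `δ / (|w|² + δ)²` is an approximate identity. With Fubini it gives `∂_{z̄} F = g` weakly
  (`BoundedDensity.integral_potential_inv_mul_dzbar`), and one more integration by parts gives
  the weak equation for `𝒯[g]`.
* The classical equation. Testing a weak equation `∂_{z̄} F = H` against bumps that shrink to a
  point where `F` is differentiable and `H` is continuous yields the equation at that point
  (`dzbar_eq_of_weak`). In `Ω` this is applied with `H = g` near the point, and off the closure of
  `Ω` with `H = 0`.
-/

open Filter Topology

namespace LameNavier

/-! ### Wirtinger calculus -/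

/-- The real-linear map `v ↦ a v + b v̄`: the Fréchet derivative of a function whose Wirtinger
derivatives are `∂_z f = a` and `∂_{z̄} f = b`. -/
noncomputable def wirtinger (a b : ℂ) : ℂ →L[ℝ] ℂ :=
  a • ContinuousLinearMap.id ℝ ℂ + b • (Complex.conjCLE : ℂ →L[ℝ] ℂ)

@[simp]
theorem wirtinger_apply (a b v : ℂ) : wirtinger a b v = a * v + b * conj v := by
  simp [wirtinger]

theorem norm_wirtinger_le (a b : ℂ) : ‖wirtinger a b‖ ≤ ‖a‖ + ‖b‖ := by
  refine ContinuousLinearMap.opNorm_le_bound _ (by positivity) fun v => ?_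
  rw [wirtinger_apply]
  refine (norm_add_le _ _).trans (le_of_eq ?_)
  rw [norm_mul, norm_mul, Complex.norm_conj]
  ring

theorem continuous_wirtinger {X : Type*} [TopologicalSpace X] {a b : X → ℂ}
    (ha : Continuous a) (hb : Continuous b) : Continuous fun x => wirtinger (a x) (b x) := by
  unfold wirtinger
  fun_prop

/-- No differentiability is needed: where `f` is not differentiable, both sides are zero. -/
theorem fderiv_eq_wirtinger (f : ℂ → ℂ) (z : ℂ) :
    fderiv ℝ f z = wirtinger (dz f z) (dzbar f z) := by
  ext v
  have hv : v = v.re • (1 : ℂ) + v.im • Complex.I := by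
    simp
  have hI : Complex.I * Complex.I = -1 := Complex.I_mul_I
  rw [wirtinger_apply, dz, dzbar]
  generalize hL : fderiv ℝ f z = L
  have h1 : L v = v.re * L 1 + v.im * L Complex.I := by
    conv_lhs => rw [hv]
    rw [map_add, map_smul, map_smul, Complex.real_smul, Complex.real_smul]
  have h2 : conj v = v.re - v.im * Complex.I := by
    apply Complex.ext <;> simp
  rw [h1, h2]
  rw [Complex.real_smul, Complex.real_smul] at hv
  linear_combination (-(1 / 2) * (L 1 - Complex.I * L Complex.I)) * hv
    + ((v.im : ℂ) * L Complex.I) * hI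

theorem _root_.HasFDerivAt.dz_eq {f : ℂ → ℂ} {a b z : ℂ} (h : HasFDerivAt f (wirtinger a b) z) :
    dz f z = a := by
  have hI : Complex.I * Complex.I = -1 := Complex.I_mul_I
  rw [dz, h.fderiv]
  simp only [wirtinger_apply, map_one, Complex.conj_I]
  linear_combination (-(a - b) / 2) * hI

theorem _root_.HasFDerivAt.dzbar_eq {f : ℂ → ℂ} {a b z : ℂ} (h : HasFDerivAt f (wirtinger a b) z) :
    dzbar f z = b := by
  have hI : Complex.I * Complex.I = -1 := Complex.I_mul_I
  rw [dzbar, h.fderiv]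
  simp only [wirtinger_apply, map_one, Complex.conj_I]
  linear_combination ((a - b) / 2) * hI

theorem hasFDerivAt_wirtinger_of_differentiableAt {f : ℂ → ℂ} {z : ℂ}
    (h : DifferentiableAt ℝ f z) : HasFDerivAt f (wirtinger (dz f z) (dzbar f z)) z :=
  fderiv_eq_wirtinger f z ▸ h.hasFDerivAt

theorem hasFDerivAt_wirtinger_id (z : ℂ) : HasFDerivAt (fun w : ℂ => w) (wirtinger 1 0) z := by
  refine (hasFDerivAt_id z).congr_fderiv ?_
  ext v
  simp

theorem hasFDerivAt_wirtinger_conj (z : ℂ) :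
    HasFDerivAt (fun w : ℂ => conj w) (wirtinger 0 1) z := by
  refine (Complex.conjCLE : ℂ →L[ℝ] ℂ).hasFDerivAt.congr_fderiv ?_
  ext v
  simp

theorem hasFDerivAt_wirtinger_const (c z : ℂ) :
    HasFDerivAt (fun _ : ℂ => c) (wirtinger 0 0) z := by
  refine (hasFDerivAt_const c z).congr_fderiv ?_
  ext v
  simp

section

variable {f g : ℂ → ℂ} {a b c d z : ℂ}

theorem _root_.HasFDerivAt.wirtinger_add (hf : HasFDerivAt f (wirtinger a b) z)
    (hg : HasFDerivAt g (wirtinger c d) z) :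
    HasFDerivAt (fun w => f w + g w) (wirtinger (a + c) (b + d)) z := by
  refine (hf.add hg).congr_fderiv ?_
  ext v
  simp
  ring

theorem _root_.HasFDerivAt.wirtinger_mul (hf : HasFDerivAt f (wirtinger a b) z)
    (hg : HasFDerivAt g (wirtinger c d) z) :
    HasFDerivAt (fun w => f w * g w)
      (wirtinger (a * g z + f z * c) (b * g z + f z * d)) z := by
  refine (hf.mul hg).congr_fderiv ?_
  ext v
  simp
  ring

theorem _root_.HasFDerivAt.wirtinger_star (hf : HasFDerivAt f (wirtinger a b) z) :
    HasFDerivAt (fun w => conj (f w)) (wirtinger (conj b) (conj a)) z := by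
  refine ((Complex.conjCLE : ℂ →L[ℝ] ℂ).hasFDerivAt.comp z hf).congr_fderiv ?_
  ext v
  simp
  ring

theorem _root_.HasDerivAt.comp_wirtinger {h : ℂ → ℂ} {h' : ℂ} (hh : HasDerivAt h h' (f z))
    (hf : HasFDerivAt f (wirtinger a b) z) :
    HasFDerivAt (fun w => h (f w)) (wirtinger (h' * a) (h' * b)) z := by
  refine ((hh.hasFDerivAt.restrictScalars ℝ).comp z hf).congr_fderiv ?_
  ext v
  simp
  ring

end

theorem dz_dzbar_comm {φ : ℂ → ℂ} (hφ : ContDiff ℝ ∞ φ) (z : ℂ) :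
    dz (dzbar φ) z = dzbar (dz φ) z := by
  have hd : Differentiable ℝ (fderiv ℝ φ) :=
    (hφ.fderiv_right (m := 1) (by norm_cast)).differentiable (by norm_num)
  have happ : ∀ v : ℂ, HasFDerivAt (fun w => fderiv ℝ φ w v)
      ((ContinuousLinearMap.apply ℝ ℂ v).comp (fderiv ℝ (fderiv ℝ φ) z)) z := fun v =>
    (ContinuousLinearMap.apply ℝ ℂ v).hasFDerivAt.comp z (hd z).hasFDerivAt
  have h1 : HasFDerivAt (dzbar φ) _ z :=
    ((happ 1).add ((happ Complex.I).const_mul Complex.I)).const_mul (1 / 2 : ℂ)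
  have h2 : HasFDerivAt (dz φ) _ z :=
    ((happ 1).sub ((happ Complex.I).const_mul Complex.I)).const_mul (1 / 2 : ℂ)
  have hs : IsSymmSndFDerivAt ℝ φ z := hφ.contDiffAt.isSymmSndFDerivAt
    (by simpa using ENat.LEInfty.out)
  have hs' := hs.eq 1 Complex.I
  rw [dz, dzbar, h1.fderiv, h2.fderiv]
  simp [hs']
  ring

theorem contDiff_dzbar {φ : ℂ → ℂ} (hφ : ContDiff ℝ ∞ φ) : ContDiff ℝ ∞ (dzbar φ) := by
  have h := hφ.fderiv_right (m := ∞) (by norm_cast)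
  unfold dzbar
  fun_prop

theorem continuous_dzbar {φ : ℂ → ℂ} (hφ : ContDiff ℝ 1 φ) : Continuous (dzbar φ) := by
  have h := hφ.continuous_fderiv (by norm_num)
  unfold dzbar
  fun_prop

theorem continuous_dz {φ : ℂ → ℂ} (hφ : ContDiff ℝ 1 φ) : Continuous (dz φ) := by
  have h := hφ.continuous_fderiv (by norm_num)
  unfold dz
  fun_prop

theorem dzbar_eq_zero_of_notMem_tsupport {φ : ℂ → ℂ} {z : ℂ} (hz : z ∉ tsupport φ) :
    dzbar φ z = 0 := by
  have h : fderiv ℝ φ z = 0 := by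
    by_contra h
    exact hz (support_fderiv_subset ℝ h)
  simp [dzbar, h]

theorem dz_eq_zero_of_notMem_tsupport {φ : ℂ → ℂ} {z : ℂ} (hz : z ∉ tsupport φ) :
    dz φ z = 0 := by
  have h : fderiv ℝ φ z = 0 := by
    by_contra h
    exact hz (support_fderiv_subset ℝ h)
  simp [dz, h]

theorem tsupport_dzbar_subset (φ : ℂ → ℂ) : tsupport (dzbar φ) ⊆ tsupport φ :=
  closure_minimal (fun _ hz => by_contra fun h => hz (dzbar_eq_zero_of_notMem_tsupport h))
    (isClosed_tsupport φ)

theorem tsupport_dz_subset (φ : ℂ → ℂ) : tsupport (dz φ) ⊆ tsupport φ :=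
  closure_minimal (fun _ hz => by_contra fun h => hz (dz_eq_zero_of_notMem_tsupport h))
    (isClosed_tsupport φ)

theorem hasCompactSupport_dzbar {φ : ℂ → ℂ} (hφ : HasCompactSupport φ) :
    HasCompactSupport (dzbar φ) :=
  HasCompactSupport.intro hφ fun _ => dzbar_eq_zero_of_notMem_tsupport

theorem hasCompactSupport_dz {φ : ℂ → ℂ} (hφ : HasCompactSupport φ) :
    HasCompactSupport (dz φ) :=
  HasCompactSupport.intro hφ fun _ => dz_eq_zero_of_notMem_tsupport

section

variable {f φ : ℂ → ℂ}

theorem integral_mul_fderiv_apply_eq_neg (hf : ContDiff ℝ 1 f) (hφ : ContDiff ℝ 1 φ)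
    (hc : HasCompactSupport φ) (v : ℂ) :
    ∫ z, f z * fderiv ℝ φ z v = -∫ z, fderiv ℝ f z v * φ z := by
  have hf' := hf.continuous_fderiv (by norm_num)
  have hφ' := hφ.continuous_fderiv (by norm_num)
  have hfc := hf.continuous
  have hφc := hφ.continuous
  have hs : HasCompactSupport (fun z => fderiv ℝ φ z v) := hc.fderiv_apply ℝ v
  refine integral_mul_fderiv_eq_neg_fderiv_mul_of_integrable ?_ ?_ ?_
    (fun x _ => hf.differentiable (by norm_num) x) (fun x _ => hφ.differentiable (by norm_num) x)
  · exact Continuous.integrable_of_hasCompactSupport (by fun_prop) hc.mul_left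
  · exact Continuous.integrable_of_hasCompactSupport (by fun_prop) hs.mul_left
  · exact Continuous.integrable_of_hasCompactSupport (by fun_prop) hc.mul_left

theorem integrable_mul_fderiv_apply (hf : ContDiff ℝ 1 f) (hφ : ContDiff ℝ 1 φ)
    (hc : HasCompactSupport φ) (v : ℂ) :
    Integrable (fun z => f z * fderiv ℝ φ z v) ∧ Integrable (fun z => fderiv ℝ f z v * φ z) := by
  have hf' := hf.continuous_fderiv (by norm_num)
  have hφ' := hφ.continuous_fderiv (by norm_num)
  have hfc := hf.continuous
  have hφc := hφ.continuous
  have hs : HasCompactSupport (fun z => fderiv ℝ φ z v) := hc.fderiv_apply ℝ v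
  exact ⟨Continuous.integrable_of_hasCompactSupport (by fun_prop) hs.mul_left,
    Continuous.integrable_of_hasCompactSupport (by fun_prop) hc.mul_left⟩

theorem integral_mul_dzbar_eq_neg (hf : ContDiff ℝ 1 f) (hφ : ContDiff ℝ 1 φ)
    (hc : HasCompactSupport φ) :
    ∫ z, f z * dzbar φ z = -∫ z, dzbar f z * φ z := by
  have h1 := integrable_mul_fderiv_apply hf hφ hc 1
  have h2 := integrable_mul_fderiv_apply hf hφ hc Complex.I
  have e1 : ∀ z, f z * dzbar φ z = (1 / 2 : ℂ) * (f z * fderiv ℝ φ z 1)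
      + (Complex.I / 2) * (f z * fderiv ℝ φ z Complex.I) := fun z => by
    rw [dzbar]; ring
  have e2 : ∀ z, dzbar f z * φ z = (1 / 2 : ℂ) * (fderiv ℝ f z 1 * φ z)
      + (Complex.I / 2) * (fderiv ℝ f z Complex.I * φ z) := fun z => by
    rw [dzbar]; ring
  simp_rw [e1, e2]
  rw [integral_add (h1.1.const_mul _) (h2.1.const_mul _),
    integral_add (h1.2.const_mul _) (h2.2.const_mul _)]
  simp_rw [integral_const_mul]
  rw [integral_mul_fderiv_apply_eq_neg hf hφ hc, integral_mul_fderiv_apply_eq_neg hf hφ hc]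
  ring

theorem integral_mul_dz_eq_neg (hf : ContDiff ℝ 1 f) (hφ : ContDiff ℝ 1 φ)
    (hc : HasCompactSupport φ) :
    ∫ z, f z * dz φ z = -∫ z, dz f z * φ z := by
  have h1 := integrable_mul_fderiv_apply hf hφ hc 1
  have h2 := integrable_mul_fderiv_apply hf hφ hc Complex.I
  have e1 : ∀ z, f z * dz φ z = (1 / 2 : ℂ) * (f z * fderiv ℝ φ z 1)
      + (-Complex.I / 2) * (f z * fderiv ℝ φ z Complex.I) := fun z => by
    rw [dz]; ring
  have e2 : ∀ z, dz f z * φ z = (1 / 2 : ℂ) * (fderiv ℝ f z 1 * φ z)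
      + (-Complex.I / 2) * (fderiv ℝ f z Complex.I * φ z) := fun z => by
    rw [dz]; ring
  simp_rw [e1, e2]
  rw [integral_add (h1.1.const_mul _) (h2.1.const_mul _),
    integral_add (h1.2.const_mul _) (h2.2.const_mul _)]
  simp_rw [integral_const_mul]
  rw [integral_mul_fderiv_apply_eq_neg hf hφ hc, integral_mul_fderiv_apply_eq_neg hf hφ hc]
  ring

end

/-! ### Convolution of a locally integrable kernel with a bounded density -/

theorem integrable_indicator_comp_sub {k : ℂ → ℂ} (hk : LocallyIntegrable k) (N : ℝ) (z : ℂ) :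
    Integrable fun ξ => (Metric.ball (0 : ℂ) N).indicator (fun w => ‖k w‖) (z - ξ) := by
  have h1 : IntegrableOn k (Metric.ball (0 : ℂ) N) :=
    (hk.integrableOn_isCompact (isCompact_closedBall 0 N)).mono_set Metric.ball_subset_closedBall
  exact ((integrable_indicator_iff measurableSet_ball).2 h1.norm).comp_sub_left z

theorem ae_ne_zero : ∀ᵐ w : ℂ, w ≠ 0 := by
  simp [ae_iff, measure_singleton]

theorem locallyIntegrable_of_norm_le {k : ℂ → ℂ} {B : ℂ → ℝ} (hB : LocallyIntegrable B)
    (hk : AEStronglyMeasurable k) (hle : ∀ w ≠ 0, ‖k w‖ ≤ B w) : LocallyIntegrable k :=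
  hB.mono hk (ae_ne_zero.mono fun w hw => (hle w hw).trans (le_abs_self _))

theorem integral_wirtinger (a b : ℂ → ℂ) (ha : Integrable a) (hb : Integrable b) :
    ∫ ξ, wirtinger (a ξ) (b ξ) = wirtinger (∫ ξ, a ξ) (∫ ξ, b ξ) := by
  unfold wirtinger
  rw [integral_add (ha.smul_const _) (hb.smul_const _), integral_smul_const, integral_smul_const]

/-- `G` is a bounded measurable function, with bound `M`, that vanishes outside the ball of
radius `R` around the origin. -/
structure BoundedDensity (G : ℂ → ℂ) (M R : ℝ) : Prop where
  aestronglyMeasurable : AEStronglyMeasurable G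
  norm_le : ∀ ξ, ‖G ξ‖ ≤ M
  eq_zero : ∀ ξ, R ≤ ‖ξ‖ → G ξ = 0

/-- The convolution `∫ k(z - ξ) G(ξ) dξ` of a kernel with a density. -/
noncomputable def potential (k G : ℂ → ℂ) (z : ℂ) : ℂ := ∫ ξ, k (z - ξ) * G ξ

namespace BoundedDensity

variable {G : ℂ → ℂ} {M R : ℝ}

theorem nonneg (hG : BoundedDensity G M R) : 0 ≤ M := (norm_nonneg _).trans (hG.norm_le 0)

theorem star (hG : BoundedDensity G M R) : BoundedDensity (fun ξ => conj (G ξ)) M R where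
  aestronglyMeasurable := Complex.continuous_conj.comp_aestronglyMeasurable hG.1
  norm_le ξ := by simpa using hG.norm_le ξ
  eq_zero ξ h := by simp [hG.eq_zero ξ h]

theorem integrable (hG : BoundedDensity G M R) : Integrable G := by
  have h : IntegrableOn G (Metric.ball 0 R) :=
    Measure.integrableOn_of_bounded (M := M) measure_ball_lt_top.ne hG.1
      (Eventually.of_forall hG.norm_le)
  refine (integrableOn_iff_integrable_of_support_subset fun ξ hξ => ?_).1 h
  by_contra hc
  exact hξ (hG.eq_zero ξ (by simpa using hc))

theorem norm_mul_le_indicator (hG : BoundedDensity G M R) (k : ℂ → ℂ) {N : ℝ} {z : ℂ}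
    (hz : ‖z‖ ≤ N) (ξ : ℂ) :
    ‖k (z - ξ) * G ξ‖ ≤ M * (Metric.ball (0 : ℂ) (N + R)).indicator (fun w => ‖k w‖) (z - ξ) := by
  by_cases hξ : R ≤ ‖ξ‖
  · rw [hG.eq_zero ξ hξ, mul_zero, norm_zero]
    exact mul_nonneg hG.nonneg (indicator_nonneg (fun _ _ => norm_nonneg _) _)
  · have : z - ξ ∈ Metric.ball (0 : ℂ) (N + R) := by
      rw [mem_ball_zero_iff]
      have := norm_sub_le z ξ
      push Not at hξ
      linarith
    rw [indicator_of_mem this, norm_mul, mul_comm]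
    exact mul_le_mul_of_nonneg_right (hG.norm_le ξ) (norm_nonneg _)

theorem integrable_mul (hG : BoundedDensity G M R) {k : ℂ → ℂ} (hk : LocallyIntegrable k) (z : ℂ) :
    Integrable fun ξ => k (z - ξ) * G ξ := by
  refine ((integrable_indicator_comp_sub hk (‖z‖ + R) z).const_mul M).mono' ?_
    (Eventually.of_forall (hG.norm_mul_le_indicator k le_rfl))
  exact (hk.aestronglyMeasurable.comp_quasiMeasurePreserving
    (quasiMeasurePreserving_sub_left volume z)).mul hG.1

theorem norm_potential_le (hG : BoundedDensity G M R) {k : ℂ → ℂ} (hk : LocallyIntegrable k)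
    {N : ℝ} {z : ℂ} (hz : ‖z‖ ≤ N) :
    ‖potential k G z‖ ≤ M * ∫ w in Metric.ball (0 : ℂ) (N + R), ‖k w‖ := by
  refine (norm_integral_le_of_norm_le
    ((integrable_indicator_comp_sub hk (N + R) z).const_mul M)
    (Eventually.of_forall (hG.norm_mul_le_indicator k hz))).trans (le_of_eq ?_)
  rw [integral_const_mul, integral_sub_left_eq_self, integral_indicator measurableSet_ball]

/-- Dominated convergence of the kernels makes the convolutions converge uniformly on balls. -/
theorem tendstoUniformlyOn_potential (hG : BoundedDensity G M R) {k : ℕ → ℂ → ℂ} {k' : ℂ → ℂ}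
    {B : ℂ → ℝ} (hB : LocallyIntegrable B) (hk : ∀ n, AEStronglyMeasurable (k n))
    (hk' : AEStronglyMeasurable k')
    (hle : ∀ n, ∀ w ≠ 0, ‖k n w‖ ≤ B w) (hle' : ∀ w ≠ 0, ‖k' w‖ ≤ B w)
    (hlim : ∀ w ≠ 0, Tendsto (fun n => k n w) atTop (𝓝 (k' w))) (N : ℝ) :
    TendstoUniformlyOn (fun n => potential (k n) G) (potential k' G) atTop
      (Metric.ball (0 : ℂ) N) := by
  have hik n := locallyIntegrable_of_norm_le hB (hk n) (hle n)
  have hik' := locallyIntegrable_of_norm_le hB hk' hle'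
  have hBi : IntegrableOn B (Metric.ball (0 : ℂ) (N + R)) :=
    (hB.integrableOn_isCompact (isCompact_closedBall 0 _)).mono_set Metric.ball_subset_closedBall
  have hzero : Tendsto (fun n => M * ∫ w in Metric.ball (0 : ℂ) (N + R), ‖k' w - k n w‖) atTop
      (𝓝 0) := by
    have := tendsto_integral_of_dominated_convergence
      (μ := volume.restrict (Metric.ball (0 : ℂ) (N + R)))
      (F := fun n w => ‖k' w - k n w‖) (f := fun _ => 0)
      (fun w => B w + B w) (fun n => (hk'.sub (hk n)).norm.restrict) (hBi.add hBi)
      (fun n => ae_restrict_of_ae (ae_ne_zero.mono fun w hw => by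
        rw [norm_norm]
        exact (norm_sub_le _ _).trans (add_le_add (hle' w hw) (hle n w hw))))
      (ae_restrict_of_ae (ae_ne_zero.mono fun w hw => by
        have := (tendsto_const_nhds (x := k' w)).sub (hlim w hw)
        simpa using this.norm))
    simpa using this.const_mul M
  rw [Metric.tendstoUniformlyOn_iff]
  intro ε hε
  filter_upwards [hzero.eventually_lt_const hε] with n hn z hz
  have hz' : ‖z‖ ≤ N := (mem_ball_zero_iff.1 hz).le
  refine lt_of_le_of_lt ?_ hn
  have e : potential k' G z - potential (k n) G z = potential (fun w => k' w - k n w) G z := by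
    unfold potential
    rw [← integral_sub (hG.integrable_mul hik' z) (hG.integrable_mul (hik n) z)]
    simp_rw [sub_mul]
  rw [dist_eq_norm, e]
  exact hG.norm_potential_le (hik'.sub (hik n)) hz'

theorem continuous_potential_of_continuous (hG : BoundedDensity G M R) {k : ℂ → ℂ}
    (hk : Continuous k) : Continuous (potential k G) := by
  rw [continuous_iff_continuousAt]
  intro z₀
  obtain ⟨C, hC⟩ := (isCompact_closedBall (0 : ℂ) (‖z₀‖ + 1 + R)).exists_bound_of_continuousOn
    hk.continuousOn
  refine continuousAt_of_dominated (bound := fun ξ => C * ‖G ξ‖) ?_ ?_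
    (hG.integrable.norm.const_mul C) ?_
  · exact Eventually.of_forall fun z => (hG.integrable_mul hk.locallyIntegrable z).1
  · filter_upwards [Metric.ball_mem_nhds z₀ one_pos] with z hz
    refine Eventually.of_forall fun ξ => ?_
    rw [norm_mul]
    by_cases hξ : R ≤ ‖ξ‖
    · simp [hG.eq_zero ξ hξ]
    · refine mul_le_mul_of_nonneg_right (hC _ ?_) (norm_nonneg _)
      rw [mem_closedBall_zero_iff]
      have h1 := norm_sub_le z ξ
      have h2 := norm_le_norm_add_norm_sub' z z₀
      have h3 : ‖z - z₀‖ < 1 := by rwa [← dist_eq_norm]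
      push Not at hξ
      linarith
  · refine Eventually.of_forall fun ξ => ?_
    fun_prop

theorem hasFDerivAt_potential_of_continuous (hG : BoundedDensity G M R) {K a b : ℂ → ℂ}
    (hK : ∀ w, HasFDerivAt K (wirtinger (a w) (b w)) w) (ha : Continuous a) (hb : Continuous b)
    (z₀ : ℂ) :
    HasFDerivAt (potential K G) (wirtinger (potential a G z₀) (potential b G z₀)) z₀ := by
  have hKc : Continuous K := continuous_iff_continuousAt.2 fun w => (hK w).continuousAt
  obtain ⟨C, hC⟩ := (isCompact_closedBall (0 : ℂ) (‖z₀‖ + 1 + R)).exists_bound_of_continuousOn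
    ha.continuousOn
  obtain ⟨D, hD⟩ := (isCompact_closedBall (0 : ℂ) (‖z₀‖ + 1 + R)).exists_bound_of_continuousOn
    hb.continuousOn
  have hai := hG.integrable_mul ha.locallyIntegrable z₀
  have hbi := hG.integrable_mul hb.locallyIntegrable z₀
  have key := hasFDerivAt_integral_of_dominated_of_fderiv_le (𝕜 := ℝ) (μ := volume)
    (F := fun z ξ => K (z - ξ) * G ξ)
    (F' := fun z ξ => wirtinger (a (z - ξ) * G ξ) (b (z - ξ) * G ξ))
    (bound := fun ξ => (C + D) * ‖G ξ‖) (Metric.ball_mem_nhds z₀ one_pos)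
    (Eventually.of_forall fun z => (hG.integrable_mul hKc.locallyIntegrable z).1)
    (hG.integrable_mul hKc.locallyIntegrable z₀) ?_ ?_ (hG.integrable.norm.const_mul _) ?_
  · rw [integral_wirtinger _ _ hai hbi] at key
    exact key
  · unfold wirtinger
    exact (hai.1.smul_const _).add (hbi.1.smul_const _)
  · refine Eventually.of_forall fun ξ z hz => (norm_wirtinger_le _ _).trans ?_
    rw [norm_mul, norm_mul, ← add_mul]
    by_cases hξ : R ≤ ‖ξ‖
    · simp [hG.eq_zero ξ hξ]
    · have hm : z - ξ ∈ Metric.closedBall (0 : ℂ) (‖z₀‖ + 1 + R) := by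
        rw [mem_closedBall_zero_iff]
        have h1 := norm_sub_le z ξ
        have h2 := norm_le_norm_add_norm_sub' z z₀
        have h3 : ‖z - z₀‖ < 1 := by rwa [← dist_eq_norm]
        push Not at hξ
        linarith
      exact mul_le_mul_of_nonneg_right (add_le_add (hC _ hm) (hD _ hm)) (norm_nonneg _)
  · refine Eventually.of_forall fun ξ z _ => ?_
    have h1 : HasFDerivAt (fun z => K (z - ξ)) (wirtinger (a (z - ξ)) (b (z - ξ))) z :=
      ((hK (z - ξ)).comp z ((hasFDerivAt_id z).sub_const ξ)).congr_fderiv (by ext v; simp)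
    refine (h1.mul_const (G ξ)).congr_fderiv ?_
    ext v
    simp
    ring

end BoundedDensity

/-- A singular kernel `K` with formal Wirtinger derivatives `a`, `b`: all three are limits, away
from the origin and dominated by one locally integrable function, of a `C¹` kernel and its actual
Wirtinger derivatives. -/
def SingularKernel (K a b : ℂ → ℂ) : Prop :=
  ∃ (Kn an bn : ℕ → ℂ → ℂ) (B : ℂ → ℝ), LocallyIntegrable B ∧
    (∀ n w, HasFDerivAt (Kn n) (wirtinger (an n w) (bn n w)) w) ∧
    (∀ n, Continuous (an n)) ∧ (∀ n, Continuous (bn n)) ∧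
    (∀ n, ∀ w ≠ 0, ‖Kn n w‖ ≤ B w ∧ ‖an n w‖ ≤ B w ∧ ‖bn n w‖ ≤ B w) ∧
    (∀ w ≠ 0, Tendsto (fun n => Kn n w) atTop (𝓝 (K w)) ∧
      Tendsto (fun n => an n w) atTop (𝓝 (a w)) ∧ Tendsto (fun n => bn n w) atTop (𝓝 (b w)))

namespace BoundedDensity

variable {G : ℂ → ℂ} {M R : ℝ}

/-- A singular kernel is locally integrable, and its convolution with a bounded density is `C¹` and
may be differentiated under the integral: the regularized potentials converge uniformly on balls
together with their first derivatives. -/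
theorem hasFDerivAt_potential (hG : BoundedDensity G M R) {K a b : ℂ → ℂ}
    (hK : SingularKernel K a b) :
    LocallyIntegrable K ∧
    (∀ z, HasFDerivAt (potential K G) (wirtinger (potential a G z) (potential b G z)) z) ∧
      Continuous (potential a G) ∧ Continuous (potential b G) := by
  obtain ⟨Kn, an, bn, B, hB, hd, hac, hbc, hle, hlim⟩ := hK
  have hKc n : Continuous (Kn n) := continuous_iff_continuousAt.2 fun w => (hd n w).continuousAt
  have meas {f : ℕ → ℂ → ℂ} {f' : ℂ → ℂ} (hf : ∀ n, Continuous (f n))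
      (hl : ∀ w ≠ 0, Tendsto (fun n => f n w) atTop (𝓝 (f' w))) : AEStronglyMeasurable f' :=
    aestronglyMeasurable_of_tendsto_ae atTop (fun n => (hf n).aestronglyMeasurable)
      (ae_ne_zero.mono hl)
  have le' {f : ℕ → ℂ → ℂ} {f' : ℂ → ℂ} (hf : ∀ n, ∀ w ≠ 0, ‖f n w‖ ≤ B w)
      (hl : ∀ w ≠ 0, Tendsto (fun n => f n w) atTop (𝓝 (f' w))) : ∀ w ≠ 0, ‖f' w‖ ≤ B w :=
    fun w hw => le_of_tendsto (hl w hw).norm (Eventually.of_forall fun n => hf n w hw)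
  have unif {f : ℕ → ℂ → ℂ} {f' : ℂ → ℂ} (hc : ∀ n, Continuous (f n))
      (hf : ∀ n, ∀ w ≠ 0, ‖f n w‖ ≤ B w)
      (hl : ∀ w ≠ 0, Tendsto (fun n => f n w) atTop (𝓝 (f' w))) (N : ℝ) :=
    hG.tendstoUniformlyOn_potential hB (fun n => (hc n).aestronglyMeasurable) (meas hc hl) hf
      (le' hf hl) hl N
  have cont {f : ℕ → ℂ → ℂ} {f' : ℂ → ℂ} (hc : ∀ n, Continuous (f n))
      (hf : ∀ n, ∀ w ≠ 0, ‖f n w‖ ≤ B w)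
      (hl : ∀ w ≠ 0, Tendsto (fun n => f n w) atTop (𝓝 (f' w))) : Continuous (potential f' G) := by
    rw [continuous_iff_continuousAt]
    intro z
    have := (unif hc hf hl (‖z‖ + 1)).continuousOn (Eventually.of_forall fun n =>
      (hG.continuous_potential_of_continuous (hc n)).continuousOn).frequently
    exact this.continuousAt (Metric.isOpen_ball.mem_nhds (by simp))
  have uK := unif hKc (fun n w hw => (hle n w hw).1) (fun w hw => (hlim w hw).1)
  have ua := unif hac (fun n w hw => (hle n w hw).2.1) (fun w hw => (hlim w hw).2.1)
  have ub := unif hbc (fun n w hw => (hle n w hw).2.2) (fun w hw => (hlim w hw).2.2)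
  refine ⟨locallyIntegrable_of_norm_le hB (meas hKc fun w hw => (hlim w hw).1)
      (le' (fun n w hw => (hle n w hw).1) fun w hw => (hlim w hw).1), fun z => ?_,
    cont hac (fun n w hw => (hle n w hw).2.1) (fun w hw => (hlim w hw).2.1),
    cont hbc (fun n w hw => (hle n w hw).2.2) (fun w hw => (hlim w hw).2.2)⟩
  refine hasFDerivAt_of_tendstoUniformlyOn (l := atTop) (s := Metric.ball (0 : ℂ) (‖z‖ + 1))
    (g' := fun z => wirtinger (potential a G z) (potential b G z))
    (f := fun n => potential (Kn n) G)
    (f' := fun n z => wirtinger (potential (an n) G z) (potential (bn n) G z))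
    Metric.isOpen_ball ?_
    (fun n w _ => hG.hasFDerivAt_potential_of_continuous (hd n) (hac n) (hbc n) w)
    (fun w hw => (uK _).tendsto_at hw) (by simp)
  have hu := Metric.tendstoUniformlyOn_iff.1 (ua (‖z‖ + 1))
  have hv := Metric.tendstoUniformlyOn_iff.1 (ub (‖z‖ + 1))
  rw [Metric.tendstoUniformlyOn_iff]
  intro ε hε
  filter_upwards [hu (ε / 2) (half_pos hε), hv (ε / 2) (half_pos hε)] with n h1 h2 w hw
  have e (p q p' q' : ℂ) : wirtinger p q - wirtinger p' q' = wirtinger (p - p') (q - q') := by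
    ext v
    simp
    ring
  rw [dist_eq_norm, e]
  refine (norm_wirtinger_le _ _).trans_lt ?_
  have h3 := h1 w hw
  have h4 := h2 w hw
  rw [dist_eq_norm] at h3 h4
  linarith

end BoundedDensity

/-! ### The regularized kernels -/

/-- The regularized squared modulus `|w|² + δ`, as a complex number. -/
noncomputable def regSq (δ : ℝ) (w : ℂ) : ℂ := w * conj w + δ

theorem regSq_eq_ofReal (δ : ℝ) (w : ℂ) : regSq δ w = ((‖w‖ ^ 2 + δ : ℝ) : ℂ) := by
  rw [regSq, Complex.mul_conj']
  push_cast
  ring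

theorem norm_regSq {δ : ℝ} (hδ : 0 < δ) (w : ℂ) : ‖regSq δ w‖ = ‖w‖ ^ 2 + δ := by
  rw [regSq_eq_ofReal, Complex.norm_real, Real.norm_of_nonneg (by positivity)]

theorem regSq_ne_zero {δ : ℝ} (hδ : 0 < δ) (w : ℂ) : regSq δ w ≠ 0 := by
  rw [← norm_pos_iff, norm_regSq hδ]
  positivity

theorem hasFDerivAt_regSq (δ : ℝ) (w : ℂ) :
    HasFDerivAt (regSq δ) (wirtinger (conj w) w) w := by
  have h := ((hasFDerivAt_wirtinger_id w).wirtinger_mul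
    (hasFDerivAt_wirtinger_conj w)).wirtinger_add (hasFDerivAt_wirtinger_const (δ : ℂ) w)
  refine h.congr_fderiv ?_
  congr 1 <;> ring

theorem continuous_regSq (δ : ℝ) : Continuous (regSq δ) :=
  continuous_iff_continuousAt.2 fun w => (hasFDerivAt_regSq δ w).continuousAt

theorem hasFDerivAt_regSq_inv {δ : ℝ} (hδ : 0 < δ) (w : ℂ) :
    HasFDerivAt (fun w => (regSq δ w)⁻¹)
      (wirtinger (-conj w / regSq δ w ^ 2) (-w / regSq δ w ^ 2)) w := by
  have h := (hasDerivAt_inv (regSq_ne_zero hδ w)).comp_wirtinger (hasFDerivAt_regSq δ w)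
  convert h using 2 <;> ring

theorem sq_norm_le_norm_regSq {δ : ℝ} (hδ : 0 < δ) (w : ℂ) : ‖w‖ ^ 2 ≤ ‖regSq δ w‖ := by
  rw [norm_regSq hδ]
  linarith

theorem norm_div_regSq_le {δ : ℝ} (hδ : 0 < δ) {w x : ℂ} (hw : w ≠ 0) (hx : ‖x‖ = ‖w‖) :
    ‖x / regSq δ w‖ ≤ ‖w‖⁻¹ := by
  have h := sq_norm_le_norm_regSq hδ w
  have hp : 0 < ‖w‖ := norm_pos_iff.2 hw
  rw [norm_div, hx, inv_eq_one_div, div_le_div_iff₀ (lt_of_lt_of_le (by positivity) h) hp]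
  nlinarith

theorem norm_div_regSq_sq_le {δ : ℝ} (hδ : 0 < δ) {w x : ℂ} (hw : w ≠ 0) (hx : ‖x‖ = ‖w‖ ^ 3) :
    ‖x / regSq δ w ^ 2‖ ≤ ‖w‖⁻¹ := by
  have h := sq_norm_le_norm_regSq hδ w
  have hp : 0 < ‖w‖ := norm_pos_iff.2 hw
  have h2 : (‖w‖ ^ 2) ^ 2 ≤ ‖regSq δ w‖ ^ 2 := pow_le_pow_left₀ (by positivity) h 2
  rw [norm_div, norm_pow, hx, inv_eq_one_div,
    div_le_div_iff₀ (lt_of_lt_of_le (by positivity) h2) hp]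
  nlinarith

/-- The regularization parameters `1 / (n + 1)`. -/
noncomputable def regParam (n : ℕ) : ℝ := 1 / ((n : ℝ) + 1)

theorem regParam_pos (n : ℕ) : 0 < regParam n := Nat.one_div_pos_of_nat

theorem regParam_le_one (n : ℕ) : regParam n ≤ 1 := by
  rw [regParam, div_le_one (by positivity)]
  linarith [n.cast_nonneg (α := ℝ)]

theorem tendsto_regParam : Tendsto regParam atTop (𝓝 0) := tendsto_one_div_add_atTop_nhds_zero_nat

theorem tendsto_regSq {δ : ℕ → ℝ} (hδ : Tendsto δ atTop (𝓝 0)) (w : ℂ) :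
    Tendsto (fun n => regSq (δ n) w) atTop (𝓝 (w * conj w)) := by
  have h : Tendsto (fun n => ((δ n : ℝ) : ℂ)) atTop (𝓝 ((0 : ℝ) : ℂ)) :=
    (Complex.continuous_ofReal.tendsto 0).comp hδ
  simpa [regSq] using h.const_add (w * conj w)

theorem tendsto_div_regSq {w : ℂ} (hw : w ≠ 0) (x : ℂ) :
    Tendsto (fun n => x / regSq (regParam n) w) atTop (𝓝 (x / (w * conj w))) :=
  tendsto_const_nhds.div (tendsto_regSq tendsto_regParam w) (by simpa using hw)

theorem tendsto_div_regSq_sq {w : ℂ} (hw : w ≠ 0) (x : ℂ) :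
    Tendsto (fun n => x / regSq (regParam n) w ^ 2) atTop (𝓝 (x / (w * conj w) ^ 2)) :=
  tendsto_const_nhds.div ((tendsto_regSq tendsto_regParam w).pow 2) (by simpa using hw)

/-- A locally integrable function that dominates both kernels and their first derivatives. -/
noncomputable def kernelBound (w : ℂ) : ℝ := 4 * ‖w‖⁻¹ + ‖w‖ ^ 2 + 2

theorem locallyIntegrable_norm_inv : LocallyIntegrable fun w : ℂ => ‖w‖⁻¹ := by
  refine locallyIntegrable_of_norm_le_rpow (C := 1) (α := 1) ?_ ?_ ?_ ?_
  · simp [Complex.finrank_real_complex]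
  · simp [Complex.finrank_real_complex]
  · refine Eventually.of_forall fun w => ?_
    simp [Real.rpow_neg_one]
  · exact (measurable_norm.inv).aestronglyMeasurable

theorem locallyIntegrable_inv : LocallyIntegrable fun w : ℂ => w⁻¹ :=
  locallyIntegrable_norm_inv.mono measurable_inv.aestronglyMeasurable
    (Eventually.of_forall fun w => by simp)

theorem locallyIntegrable_kernelBound : LocallyIntegrable kernelBound := by
  have h : Continuous fun w : ℂ => ‖w‖ ^ 2 + 2 := by fun_prop
  have h2 := (locallyIntegrable_norm_inv.smul (4 : ℝ)).add h.locallyIntegrable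
  refine h2.congr (Eventually.of_forall fun w => ?_)
  simp [kernelBound, add_assoc]

theorem singularKernel_div_conj :
    SingularKernel (fun w => w / conj w) (fun w => (conj w)⁻¹) (fun w => -w / conj w ^ 2) := by
  refine ⟨fun n w => w * w * (regSq (regParam n) w)⁻¹,
    fun n w => 2 * (w / regSq (regParam n) w) - w ^ 2 * conj w / regSq (regParam n) w ^ 2,
    fun n w => -w ^ 3 / regSq (regParam n) w ^ 2, kernelBound, locallyIntegrable_kernelBound,
    fun n w => ?_, fun n => ?_, fun n => ?_, fun n w hw => ?_, fun w hw => ?_⟩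
  · have h := ((hasFDerivAt_wirtinger_id w).wirtinger_mul
      (hasFDerivAt_wirtinger_id w)).wirtinger_mul (hasFDerivAt_regSq_inv (regParam_pos n) w)
    convert h using 2 <;> ring
  · have hq := continuous_regSq (regParam n)
    have h0 := regSq_ne_zero (regParam_pos n)
    exact (continuous_const.mul (continuous_id.div hq h0)).sub
      (((continuous_pow 2).mul Complex.continuous_conj).div (hq.pow 2)
        fun w => pow_ne_zero 2 (h0 w))
  · have hq := continuous_regSq (regParam n)
    have h0 := regSq_ne_zero (regParam_pos n)
    exact ((continuous_pow 3).neg).div (hq.pow 2) fun w => pow_ne_zero 2 (h0 w)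
  · have hp : 0 < ‖w‖ := norm_pos_iff.2 hw
    have hδ := regParam_pos n
    have hi : 0 < ‖w‖⁻¹ := inv_pos.2 hp
    have hs : 0 ≤ ‖w‖ ^ 2 := by positivity
    refine ⟨?_, ?_, ?_⟩
    · have : ‖w * w * (regSq (regParam n) w)⁻¹‖ ≤ 1 := by
        rw [norm_mul, norm_mul, norm_inv, ← div_eq_mul_inv]
        refine div_le_one_of_le₀ ?_ (norm_nonneg _)
        rw [← pow_two]
        exact sq_norm_le_norm_regSq hδ w
      unfold kernelBound
      linarith
    · have h1 := norm_div_regSq_le hδ (x := w) hw rfl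
      have h2 := norm_div_regSq_sq_le hδ (x := w ^ 2 * conj w) hw (by
        rw [norm_mul, norm_pow, Complex.norm_conj]; ring)
      refine (norm_sub_le _ _).trans ?_
      rw [norm_mul, Complex.norm_ofNat]
      unfold kernelBound
      linarith
    · have h2 := norm_div_regSq_sq_le hδ (x := -w ^ 3) hw (by rw [norm_neg, norm_pow])
      unfold kernelBound
      linarith
  · have hc : conj w ≠ 0 := by simpa using hw
    refine ⟨?_, ?_, ?_⟩
    · have h := (tendsto_div_regSq hw (w * w)).congr fun n => div_eq_mul_inv _ _
      rwa [mul_div_mul_left _ _ hw] at h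
    · have h := ((tendsto_div_regSq hw w).const_mul 2).sub
        (tendsto_div_regSq_sq hw (w ^ 2 * conj w))
      convert h using 2
      field_simp
      ring
    · have h := tendsto_div_regSq_sq hw (-w ^ 3)
      convert h using 2
      field_simp

theorem abs_log_sq_add_le {r δ : ℝ} (hr : 0 < r) (hδ : 0 < δ) (hδ1 : δ ≤ 1) :
    |Real.log (r ^ 2 + δ)| ≤ 2 * r⁻¹ + r ^ 2 := by
  have hi : 0 < r⁻¹ := inv_pos.2 hr
  rw [abs_le]
  constructor
  · have h1 : Real.log (r ^ 2) ≤ Real.log (r ^ 2 + δ) :=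
      Real.log_le_log (by positivity) (by linarith)
    have h2 : Real.log (r ^ 2) = -(2 * Real.log r⁻¹) := by
      rw [Real.log_pow, Real.log_inv]
      push_cast
      ring
    have h3 := Real.log_le_sub_one_of_pos hi
    nlinarith
  · have h3 := Real.log_le_sub_one_of_pos (show 0 < r ^ 2 + δ by positivity)
    linarith

theorem singularKernel_log :
    SingularKernel (fun w => (Real.log (‖w‖ ^ 2) : ℂ)) (fun w => w⁻¹) (fun w => (conj w)⁻¹) := by
  refine ⟨fun n w => Complex.log (regSq (regParam n) w),
    fun n w => conj w / regSq (regParam n) w,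
    fun n w => w / regSq (regParam n) w, kernelBound, locallyIntegrable_kernelBound,
    fun n w => ?_, fun n => ?_, fun n => ?_, fun n w hw => ?_, fun w hw => ?_⟩
  · have hδ := regParam_pos n
    have hs : regSq (regParam n) w ∈ Complex.slitPlane := by
      rw [regSq_eq_ofReal, Complex.ofReal_mem_slitPlane]
      positivity
    have h := (Complex.hasDerivAt_log hs).comp_wirtinger (hasFDerivAt_regSq (regParam n) w)
    convert h using 2 <;> ring
  · exact Complex.continuous_conj.div (continuous_regSq _) (regSq_ne_zero (regParam_pos n))
  · exact continuous_id.div (continuous_regSq _) (regSq_ne_zero (regParam_pos n))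
  · have hp : 0 < ‖w‖ := norm_pos_iff.2 hw
    have hδ := regParam_pos n
    have hi : 0 < ‖w‖⁻¹ := inv_pos.2 hp
    have hs : 0 ≤ ‖w‖ ^ 2 := by positivity
    refine ⟨?_, ?_, ?_⟩
    · have h := abs_log_sq_add_le hp hδ (regParam_le_one n)
      beta_reduce
      rw [regSq_eq_ofReal, ← Complex.ofReal_log (by positivity), Complex.norm_real,
        Real.norm_eq_abs]
      unfold kernelBound
      linarith
    · have h := norm_div_regSq_le hδ (x := conj w) hw (Complex.norm_conj w)
      unfold kernelBound
      linarith
    · have h := norm_div_regSq_le hδ (x := w) hw rfl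
      unfold kernelBound
      linarith
  · have hc : conj w ≠ 0 := by simpa using hw
    refine ⟨?_, ?_, ?_⟩
    · have hp : 0 < ‖w‖ := norm_pos_iff.2 hw
      have h1 : Tendsto (fun n => ‖w‖ ^ 2 + regParam n) atTop (𝓝 (‖w‖ ^ 2)) := by
        simpa using tendsto_regParam.const_add (‖w‖ ^ 2)
      have h2 := (Complex.continuous_ofReal.tendsto _).comp (h1.log (by positivity))
      refine h2.congr fun n => ?_
      have hδ := regParam_pos n
      beta_reduce
      rw [regSq_eq_ofReal, ← Complex.ofReal_log (by positivity)]
      rfl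
    · have h := tendsto_div_regSq hw (conj w)
      convert h using 2
      field_simp
    · have h := tendsto_div_regSq hw w
      convert h using 2
      field_simp

/-! ### The Cauchy-Pompeiu formula for test functions -/

theorem integral_Ioi_mul_inv_sq :
    ∫ y in Ioi (0 : ℝ), y * ((1 + y ^ 2) ^ 2)⁻¹ = 1 / 2 := by
  have hd : ∀ x : ℝ, HasDerivAt (fun y : ℝ => -(1 / 2) * (1 + y ^ 2)⁻¹)
      (x * ((1 + x ^ 2) ^ 2)⁻¹) x := fun x => by
    have h1 : HasDerivAt (fun y : ℝ => 1 + y ^ 2) (2 * x) x := by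
      simpa using (hasDerivAt_pow 2 x).const_add 1
    refine ((h1.inv (by positivity)).const_mul (-(1 / 2))).congr_deriv ?_
    field_simp
  have hl : Tendsto (fun y : ℝ => -(1 / 2) * (1 + y ^ 2)⁻¹) atTop (𝓝 (-(1 / 2) * 0)) := by
    refine Tendsto.const_mul _ (tendsto_inv_atTop_zero.comp ?_)
    exact tendsto_atTop_add_const_left _ _ (tendsto_pow_atTop two_ne_zero)
  rw [integral_Ioi_of_hasDerivAt_of_nonneg (hd 0).continuousAt.continuousWithinAt
    (fun x _ => hd x) (fun x hx => mul_nonneg (le_of_lt hx) (by positivity)) hl]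
  norm_num

theorem integral_inv_one_add_sq_sq : ∫ u : ℂ, ((1 + ‖u‖ ^ 2) ^ 2)⁻¹ = Real.pi := by
  rw [integral_fun_norm_addHaar volume (fun y : ℝ => ((1 + y ^ 2) ^ 2)⁻¹)]
  simp [Complex.finrank_real_complex, integral_Ioi_mul_inv_sq, measureReal_def]
  ring

theorem integrable_inv_one_add_sq_sq : Integrable fun u : ℂ => ((1 + ‖u‖ ^ 2) ^ 2)⁻¹ := by
  -- a non-integrable function would have integral `0`
  by_contra h
  have := integral_undef h
  rw [integral_inv_one_add_sq_sq] at this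
  exact Real.pi_ne_zero this

theorem integral_comp_add_smul (f : ℂ → ℂ) (z₀ : ℂ) {s : ℝ} (hs : 0 < s) :
    ∫ z, f z = (s : ℂ) ^ 2 * ∫ w, f (z₀ + s • w) := by
  have h := Measure.integral_comp_smul volume (fun w => f (z₀ + w)) s
  rw [h, integral_add_left_eq_self, Complex.finrank_real_complex, abs_of_pos (by positivity),
    Complex.real_smul]
  have : (s : ℂ) ≠ 0 := by exact_mod_cast hs.ne'
  push_cast
  field_simp

/-- The regularization `w̄ / (|w|² + δ)` of the Cauchy kernel `1 / w` satisfies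
`∂_{z̄} = δ / (|w|² + δ)²`, an approximation of `π` times the Dirac mass. -/
theorem dzbar_conj_mul_regSq_inv {δ : ℝ} (hδ : 0 < δ) (w : ℂ) :
    dzbar (fun w => conj w * (regSq δ w)⁻¹) w = δ / regSq δ w ^ 2 := by
  have h := ((hasFDerivAt_wirtinger_conj w).wirtinger_mul (hasFDerivAt_regSq_inv hδ w)).dzbar_eq
  rw [h]
  have h0 := regSq_ne_zero hδ w
  have e : regSq δ w = w * conj w + δ := rfl
  field_simp
  rw [e]
  ring

theorem contDiff_conj_mul_regSq_inv {δ : ℝ} (hδ : 0 < δ) :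
    ContDiff ℝ 1 fun w => conj w * (regSq δ w)⁻¹ := by
  have hc : ContDiff ℝ 1 fun w : ℂ => conj w := Complex.conjCLE.contDiff
  have hq : ContDiff ℝ 1 (regSq δ) := (contDiff_id.mul hc).add contDiff_const
  exact hc.mul (hq.inv (regSq_ne_zero hδ))

/-- The Cauchy-Pompeiu formula at the origin: integrate by parts against the regularized Cauchy
kernel and let the regularization tend to zero. -/
theorem integral_inv_mul_dzbar {φ : ℂ → ℂ} (hφ : ContDiff ℝ 1 φ) (hc : HasCompactSupport φ) :
    ∫ w, w⁻¹ * dzbar φ w = -(Real.pi * φ 0) := by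
  have hs0 : Tendsto (fun n => regParam n ^ 2) atTop (𝓝 0) := by
    simpa using tendsto_regParam.pow 2
  have hpos n : 0 < regParam n ^ 2 := pow_pos (regParam_pos n) 2
  have hdc := continuous_dzbar hφ
  have lim1 : Tendsto (fun n => ∫ w, conj w * (regSq (regParam n ^ 2) w)⁻¹ * dzbar φ w) atTop
      (𝓝 (∫ w, w⁻¹ * dzbar φ w)) := by
    refine tendsto_integral_of_dominated_convergence (fun w => ‖w‖⁻¹ * ‖dzbar φ w‖) (fun n => ?_)
      ?_ (fun n => ?_) ?_
    · exact ((contDiff_conj_mul_regSq_inv (hpos n)).continuous.mul hdc).aestronglyMeasurable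
    · exact locallyIntegrable_norm_inv.integrable_smul_right_of_hasCompactSupport hdc.norm
        (hasCompactSupport_dzbar hc).norm
    · filter_upwards [ae_ne_zero] with w hw
      rw [norm_mul, ← div_eq_mul_inv]
      exact mul_le_mul_of_nonneg_right (norm_div_regSq_le (hpos n) hw (Complex.norm_conj w))
        (norm_nonneg _)
    · filter_upwards [ae_ne_zero] with w hw
      have hcw : conj w ≠ 0 := by simpa using hw
      have h := ((tendsto_regSq hs0 w).inv₀ (mul_ne_zero hw hcw)).const_mul (conj w)
      have e : conj w * (w * conj w)⁻¹ = w⁻¹ := by field_simp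
      rw [e] at h
      exact h.mul_const _
  obtain ⟨C, hC⟩ := hφ.continuous.bounded_above_of_compact_support hc
  -- after integrating by parts, the substitution `w = s u` turns `s² / (|w|² + s²)²` into
  -- `1 / (1 + |u|²)²`
  have hval n : ∫ w, conj w * (regSq (regParam n ^ 2) w)⁻¹ * dzbar φ w
      = -∫ u, (((1 + ‖u‖ ^ 2) ^ 2)⁻¹ : ℝ) * φ (regParam n • u) := by
    rw [integral_mul_dzbar_eq_neg (contDiff_conj_mul_regSq_inv (hpos n)) hφ hc,
      integral_comp_add_smul _ 0 (regParam_pos n), ← integral_const_mul]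
    congr 2
    ext u
    have h0 : (regParam n : ℂ) ≠ 0 := by exact_mod_cast (regParam_pos n).ne'
    have h1 : ((1 + ‖u‖ ^ 2 : ℝ) : ℂ) ≠ 0 := by
      norm_cast
      positivity
    have e : regSq (regParam n ^ 2) (regParam n • u)
        = (regParam n : ℂ) ^ 2 * ((1 + ‖u‖ ^ 2 : ℝ) : ℂ) := by
      rw [regSq_eq_ofReal, norm_smul, Real.norm_of_nonneg (regParam_pos n).le]
      push_cast
      ring
    rw [zero_add, dzbar_conj_mul_regSq_inv (hpos n), e, Complex.ofReal_inv, Complex.ofReal_pow,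
      Complex.ofReal_pow]
    field_simp
  have lim2 : Tendsto (fun n => ∫ u : ℂ, (((1 + ‖u‖ ^ 2) ^ 2)⁻¹ : ℝ) * φ (regParam n • u)) atTop
      (𝓝 (∫ u : ℂ, (((1 + ‖u‖ ^ 2) ^ 2)⁻¹ : ℝ) * φ 0)) := by
    refine tendsto_integral_of_dominated_convergence (fun u => ((1 + ‖u‖ ^ 2) ^ 2)⁻¹ * C)
      (fun n => ?_) (integrable_inv_one_add_sq_sq.mul_const C)
      (fun n => Eventually.of_forall fun u => ?_) (Eventually.of_forall fun u => ?_)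
    · refine (integrable_inv_one_add_sq_sq.ofReal.aestronglyMeasurable).mul ?_
      exact (hφ.continuous.comp (continuous_const_smul _)).aestronglyMeasurable
    · rw [norm_mul, Complex.norm_real, Real.norm_of_nonneg (by positivity)]
      exact mul_le_mul_of_nonneg_left (hC _) (by positivity)
    · have h : Tendsto (fun n => regParam n • u) atTop (𝓝 0) := by
        simpa using tendsto_regParam.smul_const u
      exact ((hφ.continuous.tendsto 0).comp h).const_mul _
  have hI : ∫ u : ℂ, ((((1 + ‖u‖ ^ 2) ^ 2)⁻¹ : ℝ) : ℂ) = Real.pi := by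
    rw [← integral_inv_one_add_sq_sq]
    exact integral_ofReal
  rw [integral_mul_const, hI] at lim2
  simp_rw [hval] at lim1
  exact tendsto_nhds_unique lim1 lim2.neg

/-- The Cauchy-Pompeiu formula, which represents a function by its `∂_{z̄}` derivative, for a
compactly supported function. -/
theorem integral_inv_sub_mul_dzbar {φ : ℂ → ℂ} (hφ : ContDiff ℝ 1 φ) (hc : HasCompactSupport φ)
    (ξ : ℂ) : ∫ z, (z - ξ)⁻¹ * dzbar φ z = -(Real.pi * φ ξ) := by
  have hφ' : ContDiff ℝ 1 fun w => φ (w + ξ) := hφ.comp (contDiff_id.add contDiff_const)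
  have hc' : HasCompactSupport fun w => φ (w + ξ) := hc.comp_homeomorph (Homeomorph.addRight ξ)
  have h := integral_inv_mul_dzbar hφ' hc'
  rw [zero_add] at h
  rw [← h, ← integral_add_right_eq_self _ ξ]
  congr 1
  ext w
  rw [add_sub_cancel_right]
  simp only [dzbar, fderiv_comp_add_right]

/-! ### The Cauchy transform solves the inhomogeneous Cauchy-Riemann equation -/

/-- In the sense of distributions, `∂_{z̄}` of the Cauchy transform `∫ G(ξ) / (z - ξ) dξ` is
`π G`: interchange the integrals and apply the Cauchy-Pompeiu formula to the test function. -/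
theorem BoundedDensity.integral_potential_inv_mul_dzbar {G : ℂ → ℂ} {M R : ℝ}
    (hG : BoundedDensity G M R) {φ : ℂ → ℂ} (hφ : ContDiff ℝ 1 φ) (hc : HasCompactSupport φ) :
    ∫ z, potential (fun w => w⁻¹) G z * dzbar φ z = -(Real.pi * ∫ ξ, G ξ * φ ξ) := by
  have hdc := continuous_dzbar hφ
  have hds := hasCompactSupport_dzbar hc
  obtain ⟨C, hC⟩ := hdc.bounded_above_of_compact_support hds
  obtain ⟨N, hN⟩ := hds.isCompact.isBounded.exists_norm_le
  have hint : Integrable (fun p : ℂ × ℂ => (p.1 - p.2)⁻¹ * G p.2 * dzbar φ p.1)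
      (volume.prod volume) := by
    have hk : Integrable ((Metric.closedBall (0 : ℂ) (N + R)).indicator fun w => w⁻¹) :=
      (integrable_indicator_iff Metric.isClosed_closedBall.measurableSet).2
        (locallyIntegrable_inv.integrableOn_isCompact (isCompact_closedBall 0 _))
    have h1 := hG.integrable.convolution_integrand (ContinuousLinearMap.mul ℝ ℂ) hk
    have h2 := h1.mul_bdd (c := C) (hdc.comp continuous_fst).aestronglyMeasurable
      (Eventually.of_forall fun p => hC p.1)
    refine h2.congr (Eventually.of_forall fun p => ?_)
    by_cases hξ : R ≤ ‖p.2‖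
    · simp [hG.eq_zero _ hξ]
    by_cases hz : p.1 ∈ tsupport (dzbar φ)
    · have hm : p.1 - p.2 ∈ Metric.closedBall (0 : ℂ) (N + R) := by
        rw [mem_closedBall_zero_iff]
        have := norm_sub_le p.1 p.2
        have := hN _ hz
        push Not at hξ
        linarith
      simp [indicator_of_mem hm, mul_comm]
    · simp [image_eq_zero_of_notMem_tsupport hz]
  calc ∫ z, potential (fun w => w⁻¹) G z * dzbar φ z
      = ∫ z, ∫ ξ, (z - ξ)⁻¹ * G ξ * dzbar φ z := by
        simp_rw [potential, integral_mul_const]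
    _ = ∫ ξ, ∫ z, (z - ξ)⁻¹ * G ξ * dzbar φ z := integral_integral_swap hint
    _ = ∫ ξ, G ξ * -(Real.pi * φ ξ) := by
        congr 1
        ext ξ
        rw [← integral_inv_sub_mul_dzbar hφ hc ξ, ← integral_const_mul]
        congr 1
        ext z
        ring
    _ = -(Real.pi * ∫ ξ, G ξ * φ ξ) := by
        rw [← integral_const_mul, ← integral_neg]
        congr 1
        ext ξ
        ring

theorem dzbar_comp_smul_sub {φ : ℂ → ℂ} (hφ : Differentiable ℝ φ) (c : ℝ) (z₀ z : ℂ) :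
    dzbar (fun z => φ (c • (z - z₀))) z = c * dzbar φ (c • (z - z₀)) := by
  have h1 : HasFDerivAt (fun z : ℂ => c • (z - z₀)) (c • ContinuousLinearMap.id ℝ ℂ) z :=
    ((hasFDerivAt_id z).sub_const z₀).const_smul c
  have h2 := (hasFDerivAt_wirtinger_of_differentiableAt (hφ (c • (z - z₀)))).comp z h1
  have h3 : HasFDerivAt (fun z => φ (c • (z - z₀)))
      (wirtinger (c * dz φ (c • (z - z₀))) (c * dzbar φ (c • (z - z₀)))) z := by
    refine h2.congr_fderiv ?_
    ext v
    simp
    ring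
  exact h3.dzbar_eq

/-- A weak solution of `∂_{z̄} F = H` satisfies the equation classically at every point where `F`
is differentiable and `H` is continuous: test against bumps that shrink to the point. -/
theorem dzbar_eq_of_weak {F H : ℂ → ℂ} {M : ℝ} (hF : Continuous F)
    (hHm : AEStronglyMeasurable H) (hHb : ∀ z, ‖H z‖ ≤ M)
    (hw : ∀ φ : ℂ → ℂ, ContDiff ℝ ∞ φ → HasCompactSupport φ →
      ∫ z, F z * dzbar φ z = -∫ z, H z * φ z)
    {z₀ : ℂ} (hd : DifferentiableAt ℝ F z₀) (hc : ContinuousAt H z₀) :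
    dzbar F z₀ = H z₀ := by
  let ρ : ContDiffBump (0 : ℂ) := ⟨1, 2, one_pos, one_lt_two⟩
  set φ : ℂ → ℂ := fun w => (ρ w : ℂ) with hφdef
  have hφ : ContDiff ℝ ∞ φ := Complex.ofRealCLM.contDiff.comp ρ.contDiff
  have hφ1 : ContDiff ℝ 1 φ := hφ.of_le (by norm_cast)
  have hφs : HasCompactSupport φ := ρ.hasCompactSupport.comp_left Complex.ofReal_zero
  have hφi : ∫ w, φ w ≠ 0 := by
    have h : ∫ w, φ w = ((∫ w, ρ w : ℝ) : ℂ) := integral_ofReal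
    rw [h]
    exact_mod_cast (ρ.integral_pos (μ := volume)).ne'
  have hdc := continuous_dzbar hφ1
  have hds := hasCompactSupport_dzbar hφs
  have hd0 : ∫ w, dzbar φ w = 0 := by
    have h := integral_mul_dzbar_eq_neg (f := fun _ => (1 : ℂ)) contDiff_const hφ1 hφs
    simpa [(hasFDerivAt_wirtinger_const 1 _).dzbar_eq] using h
  set c : ℕ → ℝ := fun n => n + 1 with hcdef
  have hcpos n : 0 < c n := by positivity
  have hcinv : Tendsto (fun n => (c n)⁻¹) atTop (𝓝 0) := by
    simpa [c] using tendsto_one_div_add_atTop_nhds_zero_nat (𝕜 := ℝ)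
  -- the weak equation for `φ (c (z - z₀))`, written in the variable `w = c (z - z₀)`
  have key n : ∫ w, c n • (F (z₀ + (c n)⁻¹ • w) - F z₀) * dzbar φ w
      = -∫ w, H (z₀ + (c n)⁻¹ • w) * φ w := by
    have hn := (hcpos n).ne'
    have hnc : (c n : ℂ) ≠ 0 := by exact_mod_cast hn
    have hψ : ContDiff ℝ ∞ fun z => φ (c n • (z - z₀)) :=
      hφ.comp ((contDiff_id.sub contDiff_const).const_smul (c n))
    have hψs : HasCompactSupport fun z => φ (c n • (z - z₀)) :=
      hφs.comp_homeomorph ((Homeomorph.subRight z₀).trans (Homeomorph.smulOfNeZero (c n) hn))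
    have h := hw _ hψ hψs
    rw [integral_comp_add_smul _ z₀ (inv_pos.2 (hcpos n)),
      integral_comp_add_smul (fun z => H z * φ (c n • (z - z₀))) z₀ (inv_pos.2 (hcpos n)),
      ← mul_neg] at h
    have h2 := mul_left_cancel₀ (by simpa using hnc) h
    simp only [dzbar_comp_smul_sub (hφ1.differentiable one_ne_zero), add_sub_cancel_left,
      smul_inv_smul₀ hn] at h2
    rw [← h2]
    have hi1 : Integrable fun w => F (z₀ + (c n)⁻¹ • w) * (c n * dzbar φ w) :=
      Continuous.integrable_of_hasCompactSupport (by fun_prop) (hds.mul_left.mul_left)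
    have hi2 : Integrable fun w => (c n * F z₀) * dzbar φ w :=
      (hdc.integrable_of_hasCompactSupport hds).const_mul _
    have e : ∀ w, c n • (F (z₀ + (c n)⁻¹ • w) - F z₀) * dzbar φ w
        = F (z₀ + (c n)⁻¹ • w) * (c n * dzbar φ w) - (c n * F z₀) * dzbar φ w := fun w => by
      rw [Complex.real_smul]
      ring
    simp_rw [e]
    rw [integral_sub hi1 hi2, integral_const_mul, hd0, mul_zero, sub_zero]
  have hDF := hasFDerivAt_wirtinger_of_differentiableAt hd
  have hsupp : ∀ w, dzbar φ w ≠ 0 → ‖w‖ ≤ 2 := fun w hw => by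
    by_contra hlt
    refine hw (dzbar_eq_zero_of_notMem_tsupport fun hmem => hlt ?_)
    have h1 : tsupport φ ⊆ tsupport ρ := tsupport_comp_subset Complex.ofReal_zero _
    simpa [ρ.tsupport_eq] using h1 hmem
  have lim1 : Tendsto (fun n => ∫ w, c n • (F (z₀ + (c n)⁻¹ • w) - F z₀) * dzbar φ w) atTop
      (𝓝 (∫ w, wirtinger (dz F z₀) (dzbar F z₀) w * dzbar φ w)) := by
    obtain ⟨C, hC⟩ := hDF.isBigO_sub.bound
    obtain ⟨r, hr, hball⟩ := Metric.eventually_nhds_iff.1 hC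
    refine tendsto_integral_filter_of_dominated_convergence (fun w => |C| * 2 * ‖dzbar φ w‖)
      (Eventually.of_forall fun n => ?_) ?_
      ((hdc.integrable_of_hasCompactSupport hds).norm.const_mul _)
      (Eventually.of_forall fun w => ?_)
    · exact Continuous.aestronglyMeasurable (by fun_prop)
    · have hsmall : ∀ᶠ n in atTop, (c n)⁻¹ < r / 2 := hcinv.eventually_lt_const (half_pos hr)
      filter_upwards [hsmall] with n hn
      refine Eventually.of_forall fun w => ?_
      by_cases h0 : dzbar φ w = 0
      · simp [h0]
      have hw2 := hsupp w h0
      have hip : 0 < (c n)⁻¹ := inv_pos.2 (hcpos n)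
      have hnw : ‖(c n)⁻¹ • w‖ = (c n)⁻¹ * ‖w‖ := by
        rw [norm_smul, Real.norm_of_nonneg hip.le]
      have hb := hball (y := z₀ + (c n)⁻¹ • w) (by
        rw [dist_eq_norm, add_sub_cancel_left, hnw]
        nlinarith [norm_nonneg w])
      rw [add_sub_cancel_left, hnw] at hb
      rw [norm_mul, norm_smul, Real.norm_of_nonneg (hcpos n).le]
      refine mul_le_mul_of_nonneg_right ?_ (norm_nonneg _)
      calc c n * ‖F (z₀ + (c n)⁻¹ • w) - F z₀‖ ≤ c n * (C * ((c n)⁻¹ * ‖w‖)) :=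
            mul_le_mul_of_nonneg_left hb (hcpos n).le
        _ = C * ‖w‖ := by
            have := (hcpos n).ne'
            field_simp
        _ ≤ |C| * 2 := mul_le_mul (le_abs_self C) hw2 (norm_nonneg _) (abs_nonneg _)
    · refine (hDF.lim w ?_).mul_const _
      simp_rw [Real.norm_of_nonneg (hcpos _).le]
      exact tendsto_atTop_add_const_right _ _ tendsto_natCast_atTop_atTop
  have lim2 : Tendsto (fun n => ∫ w, H (z₀ + (c n)⁻¹ • w) * φ w) atTop
      (𝓝 (∫ w, H z₀ * φ w)) := by
    refine tendsto_integral_of_dominated_convergence (fun w => M * ‖φ w‖) (fun n => ?_)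
      ((hφ.continuous.integrable_of_hasCompactSupport hφs).norm.const_mul _)
      (fun n => Eventually.of_forall fun w => ?_) (Eventually.of_forall fun w => ?_)
    · refine AEStronglyMeasurable.mul ?_ hφ.continuous.aestronglyMeasurable
      refine hHm.comp_quasiMeasurePreserving ?_
      exact (measurePreserving_add_left volume z₀).quasiMeasurePreserving.comp
        (Measure.quasiMeasurePreserving_smul volume (inv_pos.2 (hcpos n)).ne')
    · rw [norm_mul]
      exact mul_le_mul_of_nonneg_right (hHb _) (norm_nonneg _)
    · have h : Tendsto (fun n => z₀ + (c n)⁻¹ • w) atTop (𝓝 z₀) := by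
        simpa using (hcinv.smul_const w).const_add z₀
      exact (hc.tendsto.comp h).mul_const _
  simp_rw [key] at lim1
  have heq := tendsto_nhds_unique lim1 lim2.neg
  have hlin : ContDiff ℝ 1 fun w => wirtinger (dz F z₀) (dzbar F z₀) w :=
    (wirtinger (dz F z₀) (dzbar F z₀)).contDiff
  rw [integral_mul_dzbar_eq_neg hlin hφ1 hφs, neg_inj] at heq
  simp_rw [((wirtinger (dz F z₀) (dzbar F z₀)).hasFDerivAt).dzbar_eq, integral_const_mul] at heq
  exact mul_right_cancel₀ hφi heq

/-! ### Smoothness of potentials away from the density -/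

/-- Off the support of the density only the values of the kernel on an annulus matter, so the kernel
may be replaced by a compactly supported smooth one. -/
theorem BoundedDensity.contDiffAt_potential {G : ℂ → ℂ} {M R : ℝ} (hG : BoundedDensity G M R)
    {K : ℂ → ℂ} (hK : ∀ w ≠ 0, ContDiffAt ℝ ∞ K w) {z : ℂ} {δ : ℝ} (hδ : 0 < δ)
    (hz : ∀ ξ, ‖z - ξ‖ < δ → G ξ = 0) : ContDiffAt ℝ ∞ (potential K G) z := by
  have hN : 0 < ‖z‖ + δ + |R| := by positivity
  let ρ₁ : ContDiffBump (0 : ℂ) := ⟨δ / 4, δ / 2, by positivity, by linarith⟩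
  let ρ₂ : ContDiffBump (0 : ℂ) := ⟨‖z‖ + δ + |R|, ‖z‖ + δ + |R| + 1, hN, by linarith⟩
  set χ : ℂ → ℂ := fun w => (((1 - ρ₁ w) * ρ₂ w : ℝ) : ℂ) * K w with hχ
  have hχc : HasCompactSupport χ := by
    refine HasCompactSupport.intro ρ₂.hasCompactSupport fun w hw => ?_
    simp [hχ, image_eq_zero_of_notMem_tsupport hw]
  have hχs : ContDiff ℝ ∞ χ := by
    rw [contDiff_iff_contDiffAt]
    intro w
    by_cases hw : w = 0
    · subst hw
      have h : χ =ᶠ[𝓝 0] fun _ => 0 := by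
        filter_upwards [ρ₁.eventuallyEq_one] with w hw
        simp [hχ, hw]
      exact contDiffAt_const.congr_of_eventuallyEq h
    · have h : ContDiff ℝ ∞ fun w => (((1 - ρ₁ w) * ρ₂ w : ℝ) : ℂ) :=
        Complex.ofRealCLM.contDiff.comp ((contDiff_const.sub ρ₁.contDiff).mul ρ₂.contDiff)
      exact h.contDiffAt.mul (hK w hw)
  have hconv : ContDiff ℝ ∞ (convolution G χ (ContinuousLinearMap.mul ℝ ℂ) volume) :=
    hχc.contDiff_convolution_right (n := ⊤) _ hG.integrable.locallyIntegrable hχs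
  refine hconv.contDiffAt.congr_of_eventuallyEq ?_
  filter_upwards [Metric.ball_mem_nhds z (half_pos hδ)] with z' hz'
  rw [convolution_def, potential]
  congr 1
  ext ξ
  rw [ContinuousLinearMap.mul_apply']
  by_cases h0 : G ξ = 0
  · simp [h0]
  have hzz : ‖z - z'‖ < δ / 2 := by
    rw [← dist_eq_norm, dist_comm]
    exact hz'
  have h1 : δ ≤ ‖z - ξ‖ := by
    by_contra h
    exact h0 (hz ξ (not_le.1 h))
  have h2 : ‖ξ‖ < R := by
    by_contra h
    exact h0 (hG.eq_zero ξ (not_lt.1 h))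
  have h3 : ‖z - ξ‖ ≤ ‖z - z'‖ + ‖z' - ξ‖ := norm_sub_le_norm_sub_add_norm_sub z z' ξ
  have h4 : ‖z' - ξ‖ ≤ ‖z'‖ + ‖ξ‖ := norm_sub_le z' ξ
  have h5 : ‖z'‖ ≤ ‖z‖ + ‖z - z'‖ := norm_le_norm_add_norm_sub z z'
  have e1 : ρ₁ (z' - ξ) = 0 := ρ₁.zero_of_le_dist (by
    rw [dist_zero_right]
    change δ / 2 ≤ _
    linarith)
  have e2 : ρ₂ (z' - ξ) = 1 := ρ₂.one_of_mem_closedBall (by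
    rw [mem_closedBall_zero_iff]
    change _ ≤ ‖z‖ + δ + |R|
    linarith [le_abs_self R])
  simp [hχ, e1, e2, mul_comm]

theorem contDiffAt_conj {f : ℂ → ℂ} {z : ℂ} (hf : ContDiffAt ℝ ∞ f z) :
    ContDiffAt ℝ ∞ (fun w => conj (f w)) z :=
  Complex.conjCLE.contDiff.contDiffAt.comp z hf

theorem contDiffAt_div_conj {w : ℂ} (hw : w ≠ 0) : ContDiffAt ℝ ∞ (fun w : ℂ => w / conj w) w :=
  contDiffAt_id.mul ((contDiffAt_conj contDiffAt_id).inv (by simpa using hw))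

theorem contDiffAt_log_norm_sq {w : ℂ} (hw : w ≠ 0) :
    ContDiffAt ℝ ∞ (fun w : ℂ => (Real.log (‖w‖ ^ 2) : ℂ)) w :=
  Complex.ofRealCLM.contDiff.contDiffAt.comp w
    ((contDiff_norm_sq ℝ).contDiffAt.log (by simpa using hw))

theorem differentiableAt_dz {f : ℂ → ℂ} {z : ℂ} (hf : ContDiffAt ℝ ∞ f z) :
    DifferentiableAt ℝ (dz f) z := by
  have h := (hf.fderiv_right (m := 1) (by norm_cast)).differentiableAt one_ne_zero
  unfold dz
  fun_prop

theorem differentiableAt_dzbar {f : ℂ → ℂ} {z : ℂ} (hf : ContDiffAt ℝ ∞ f z) :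
    DifferentiableAt ℝ (dzbar f) z := by
  have h := (hf.fderiv_right (m := 1) (by norm_cast)).differentiableAt one_ne_zero
  unfold dzbar
  fun_prop

/-! ### The Teodorescu type operator -/

section

variable {α β : ℝ} {Ω : Set ℂ} {g : ℂ → ℂ}

theorem exists_boundedDensity_indicator (hΩ : IsOpen Ω) (hΩb : Bornology.IsBounded Ω)
    (hg : ContinuousOn g (closure Ω)) : ∃ M R, BoundedDensity (Ω.indicator g) M R := by
  obtain ⟨M, hM⟩ := hΩb.isCompact_closure.exists_bound_of_continuousOn hg
  obtain ⟨R, -, hR⟩ := hΩb.exists_pos_norm_lt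
  refine ⟨max M 0, R, ?_, fun ξ => ?_, fun ξ hξ => ?_⟩
  · exact (aestronglyMeasurable_indicator_iff hΩ.measurableSet).2
      ((hg.mono subset_closure).aestronglyMeasurable hΩ.measurableSet)
  · by_cases h : ξ ∈ Ω
    · rw [indicator_of_mem h]
      exact (hM ξ (subset_closure h)).trans (le_max_left _ _)
    · rw [indicator_of_notMem h, norm_zero]
      exact le_max_right _ _
  · exact indicator_of_notMem (fun h => (hR ξ h).not_ge hξ) _

theorem indicator_teodorescuIntegrand (z ξ : ℂ) :
    Ω.indicator (teodorescuIntegrand α β g z) ξ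
      = (alphaStar α β : ℂ) * ((z - ξ) / conj (z - ξ) * conj (Ω.indicator g ξ))
        - (betaStar α β : ℂ) * ((Real.log (‖z - ξ‖ ^ 2) : ℂ) * Ω.indicator g ξ) := by
  by_cases h : ξ ∈ Ω
  · rw [indicator_of_mem h, indicator_of_mem h, teodorescuIntegrand, norm_sub_rev ξ z,
      ← neg_sub z ξ, map_neg, neg_div_neg_eq]
    ring
  · simp [indicator_of_notMem h]

variable {M R : ℝ}

theorem integrableOn_teodorescuIntegrand (hΩ : IsOpen Ω)
    (hG : BoundedDensity (Ω.indicator g) M R) (z : ℂ) :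
    IntegrableOn (teodorescuIntegrand α β g z) Ω := by
  rw [← integrable_indicator_iff hΩ.measurableSet]
  have h1 := hG.star.integrable_mul (hG.hasFDerivAt_potential singularKernel_div_conj).1 z
  have h2 := hG.integrable_mul (hG.hasFDerivAt_potential singularKernel_log).1 z
  refine ((h1.const_mul (alphaStar α β : ℂ)).sub (h2.const_mul (betaStar α β : ℂ))).congr
    (Eventually.of_forall fun ξ => ?_)
  exact (indicator_teodorescuIntegrand z ξ).symm

theorem teodorescu_eq_potential (hΩ : IsOpen Ω) (hG : BoundedDensity (Ω.indicator g) M R) :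
    teodorescu α β Ω g = fun z =>
      (alphaStar α β / Real.pi : ℂ) *
          potential (fun w => w / conj w) (fun ξ => conj (Ω.indicator g ξ)) z
        + (-betaStar α β / Real.pi : ℂ) *
          potential (fun w => (Real.log (‖w‖ ^ 2) : ℂ)) (Ω.indicator g) z := by
  ext z
  have h1 := hG.star.integrable_mul (hG.hasFDerivAt_potential singularKernel_div_conj).1 z
  have h2 := hG.integrable_mul (hG.hasFDerivAt_potential singularKernel_log).1 z
  rw [teodorescu, ← integral_indicator hΩ.measurableSet]
  simp_rw [indicator_teodorescuIntegrand]
  rw [integral_sub (h1.const_mul _) (h2.const_mul _), integral_const_mul, integral_const_mul]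
  unfold potential
  ring

theorem hasFDerivAt_teodorescu (hΩ : IsOpen Ω) (hG : BoundedDensity (Ω.indicator g) M R) (z : ℂ) :
    HasFDerivAt (teodorescu α β Ω g)
      (wirtinger
        ((alphaStar α β / Real.pi : ℂ) *
            potential (fun w => (conj w)⁻¹) (fun ξ => conj (Ω.indicator g ξ)) z
          + (-betaStar α β / Real.pi : ℂ) * potential (fun w => w⁻¹) (Ω.indicator g) z)
        ((alphaStar α β / Real.pi : ℂ) *
            potential (fun w => -w / conj w ^ 2) (fun ξ => conj (Ω.indicator g ξ)) z
          + (-betaStar α β / Real.pi : ℂ) *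
            potential (fun w => (conj w)⁻¹) (Ω.indicator g) z)) z := by
  rw [teodorescu_eq_potential hΩ hG]
  have h1 := (hG.star.hasFDerivAt_potential singularKernel_div_conj).2.1 z
  have h2 := (hG.hasFDerivAt_potential singularKernel_log).2.1 z
  have h := ((hasFDerivAt_wirtinger_const (alphaStar α β / Real.pi : ℂ) z).wirtinger_mul
    h1).wirtinger_add
      ((hasFDerivAt_wirtinger_const (-betaStar α β / Real.pi : ℂ) z).wirtinger_mul h2)
  refine h.congr_fderiv ?_
  congr 1 <;> ring

theorem contDiff_one_teodorescu (hΩ : IsOpen Ω) (hG : BoundedDensity (Ω.indicator g) M R) :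
    ContDiff ℝ 1 (teodorescu α β Ω g) := by
  refine contDiff_one_iff_hasFDerivAt.2 ⟨_, ?_, hasFDerivAt_teodorescu hΩ hG⟩
  have h1 := (hG.star.hasFDerivAt_potential singularKernel_div_conj).2.2
  have h2 := (hG.hasFDerivAt_potential singularKernel_log).2.2
  exact continuous_wirtinger ((h1.1.const_mul _).add (h2.1.const_mul _))
    ((h1.2.const_mul _).add (h2.2.const_mul _))

theorem conj_potential (k G : ℂ → ℂ) (z : ℂ) :
    conj (potential k G z) = potential (fun w => conj (k w)) (fun ξ => conj (G ξ)) z := by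
  unfold potential
  rw [← integral_conj]
  simp

/-- The first-order part of `L_{α,β}` turns the Teodorescu type operator into the Cauchy transform:
by the choice of `α*` and `β*` the terms containing `ḡ` cancel. -/
theorem lame_first_order_teodorescu (hΩ : IsOpen Ω) (hG : BoundedDensity (Ω.indicator g) M R)
    (hne : α ^ 2 - β ^ 2 ≠ 0) (z : ℂ) :
    (α : ℂ) * dzbar (fun w => conj (teodorescu α β Ω g w)) z
        + (β : ℂ) * dz (teodorescu α β Ω g) z
      = (Real.pi : ℂ)⁻¹ * potential (fun w => w⁻¹) (Ω.indicator g) z := by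
  have h := hasFDerivAt_teodorescu (α := α) (β := β) hΩ hG z
  rw [h.wirtinger_star.dzbar_eq, h.dz_eq]
  have e : (α : ℂ) * alphaStar α β - β * betaStar α β = 1 := by
    rw [alphaStar, betaStar]
    norm_cast
    field_simp
  have e2 : (α : ℂ) * betaStar α β = β * alphaStar α β := by
    rw [alphaStar, betaStar]
    norm_cast
    ring
  simp only [map_add, map_mul, map_div₀, map_neg, Complex.conj_ofReal, conj_potential, map_inv₀,
    Complex.conj_conj]
  generalize potential (fun w => w⁻¹) (Ω.indicator g) z = p
  generalize potential (fun w => (conj w)⁻¹) (fun ξ => conj (Ω.indicator g ξ)) z = q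
  linear_combination (p * (Real.pi : ℂ)⁻¹) * e - (q * (Real.pi : ℂ)⁻¹) * e2

theorem integral_lame_first_order_mul_dzbar (hΩ : IsOpen Ω)
    (hG : BoundedDensity (Ω.indicator g) M R) (hne : α ^ 2 - β ^ 2 ≠ 0) {φ : ℂ → ℂ}
    (hφ : ContDiff ℝ ∞ φ) (hc : HasCompactSupport φ) :
    ∫ z, ((α : ℂ) * dzbar (fun w => conj (teodorescu α β Ω g w)) z
        + (β : ℂ) * dz (teodorescu α β Ω g) z) * dzbar φ z = -∫ z, Ω.indicator g z * φ z := by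
  have hpi : (Real.pi : ℂ) ≠ 0 := by exact_mod_cast Real.pi_ne_zero
  simp_rw [lame_first_order_teodorescu hΩ hG hne, mul_assoc]
  rw [integral_const_mul, hG.integral_potential_inv_mul_dzbar (hφ.of_le (by norm_cast)) hc]
  field_simp

theorem lameOpEqWeak_teodorescu (hΩ : IsOpen Ω) (hG : BoundedDensity (Ω.indicator g) M R)
    (hne : α ^ 2 - β ^ 2 ≠ 0) : LameOpEqWeak α β Ω (teodorescu α β Ω g) g := by
  have hT := contDiff_one_teodorescu (α := α) (β := β) hΩ hG
  refine ⟨hT.continuous.locallyIntegrable.locallyIntegrableOn Ω,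
    ((integrable_indicator_iff hΩ.measurableSet).1 hG.integrable).locallyIntegrableOn,
    fun φ hφ hc hsub => ?_⟩
  set T := teodorescu α β Ω g with hTdef
  have hTc : ContDiff ℝ 1 fun z => conj (T z) := Complex.conjCLE.contDiff.comp hT
  have hD := contDiff_dzbar hφ
  have hDs := hasCompactSupport_dzbar hc
  have hD1 : ContDiff ℝ 1 (dzbar φ) := hD.of_le (by norm_cast)
  have hz1 : ∀ z ∉ Ω, dzbar (dzbar φ) z = 0 := fun z hz =>
    dzbar_eq_zero_of_notMem_tsupport fun h => hz (hsub (tsupport_dzbar_subset φ h))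
  have hz2 : ∀ z ∉ Ω, dzbar (dz φ) z = 0 := fun z hz =>
    dzbar_eq_zero_of_notMem_tsupport fun h => hz (hsub (tsupport_dz_subset φ h))
  rw [setIntegral_eq_integral_of_forall_compl_eq_zero fun z hz => by
    rw [hz1 z hz, hz2 z hz, mul_zero, mul_zero, add_zero]]
  simp_rw [← dz_dzbar_comm hφ, mul_assoc]
  have i1 : Integrable fun z => conj (T z) * dzbar (dzbar φ) z :=
    (hTc.continuous.mul (continuous_dzbar hD1)).integrable_of_hasCompactSupport
      (hasCompactSupport_dzbar hDs).mul_left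
  have i2 : Integrable fun z => T z * dz (dzbar φ) z :=
    (hT.continuous.mul (continuous_dz hD1)).integrable_of_hasCompactSupport
      (hasCompactSupport_dz hDs).mul_left
  have i3 : Integrable fun z => dzbar (fun w => conj (T w)) z * dzbar φ z :=
    ((continuous_dzbar hTc).mul hD.continuous).integrable_of_hasCompactSupport hDs.mul_left
  have i4 : Integrable fun z => dz T z * dzbar φ z :=
    ((continuous_dz hT).mul hD.continuous).integrable_of_hasCompactSupport hDs.mul_left
  have h := integral_lame_first_order_mul_dzbar (α := α) (β := β) hΩ hG hne hφ hc
  simp_rw [add_mul, mul_assoc] at h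
  rw [integral_add (i3.const_mul _) (i4.const_mul _), integral_const_mul, integral_const_mul] at h
  rw [integral_add (i1.const_mul _) (i2.const_mul _), integral_const_mul, integral_const_mul,
    integral_mul_dzbar_eq_neg hTc hD1 hDs, integral_mul_dz_eq_neg hT hD1 hDs,
    ← integral_indicator hΩ.measurableSet]
  simp_rw [indicator_mul_left]
  linear_combination -h

/-- Where the first derivatives of the Teodorescu type operator are differentiable and the extension
of `g` by zero is continuous, the equation holds classically. -/
theorem lameOp_teodorescu (hΩ : IsOpen Ω) (hG : BoundedDensity (Ω.indicator g) M R)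
    (hne : α ^ 2 - β ^ 2 ≠ 0) {z : ℂ} (hc : ContinuousAt (Ω.indicator g) z)
    (h1 : DifferentiableAt ℝ (dzbar fun w => conj (teodorescu α β Ω g w)) z)
    (h2 : DifferentiableAt ℝ (dz (teodorescu α β Ω g)) z) :
    lameOp α β (teodorescu α β Ω g) z = Ω.indicator g z := by
  have hT := contDiff_one_teodorescu (α := α) (β := β) hΩ hG
  have hTc : ContDiff ℝ 1 fun z => conj (teodorescu α β Ω g z) :=
    Complex.conjCLE.contDiff.comp hT
  have h := dzbar_eq_of_weak
    (F := fun w => (α : ℂ) * dzbar (fun w => conj (teodorescu α β Ω g w)) w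
      + (β : ℂ) * dz (teodorescu α β Ω g) w)
    (((continuous_dzbar hTc).const_mul (α : ℂ)).add ((continuous_dz hT).const_mul (β : ℂ)))
    hG.1 hG.2
    (fun φ hφ hs => integral_lame_first_order_mul_dzbar hΩ hG hne hφ hs)
    ((h1.const_mul _).add (h2.const_mul _)) hc
  rw [← h, (((hasFDerivAt_wirtinger_const (α : ℂ) z).wirtinger_mul
    (hasFDerivAt_wirtinger_of_differentiableAt h1)).wirtinger_add
      ((hasFDerivAt_wirtinger_const (β : ℂ) z).wirtinger_mul
        (hasFDerivAt_wirtinger_of_differentiableAt h2))).dzbar_eq, lameOp]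
  ring

theorem contDiffAt_teodorescu (hΩ : IsOpen Ω) (hG : BoundedDensity (Ω.indicator g) M R) {z : ℂ}
    (hz : z ∈ (closure Ω)ᶜ) : ContDiffAt ℝ ∞ (teodorescu α β Ω g) z := by
  obtain ⟨δ, hδ, hball⟩ := Metric.isOpen_iff.1 isClosed_closure.isOpen_compl z hz
  have h0 : ∀ ξ, ‖z - ξ‖ < δ → Ω.indicator g ξ = 0 := fun ξ hξ =>
    indicator_of_notMem (fun h => hball (by rwa [Metric.mem_ball', dist_eq_norm])
      (subset_closure h)) _
  rw [teodorescu_eq_potential hΩ hG]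
  exact (contDiffAt_const.mul (hG.star.contDiffAt_potential (fun w => contDiffAt_div_conj) hδ
    fun ξ hξ => by rw [h0 ξ hξ, map_zero])).add
      (contDiffAt_const.mul (hG.contDiffAt_potential (fun w => contDiffAt_log_norm_sq) hδ h0))

end

end LameNavier

theorem mainTheorem2 (lam mu : ℝ) (hmu : 0 < mu) (hlam : -(2 * mu / 3) < lam)
    (α β : ℝ) (hα : α = LameNavier.lameAlpha lam mu) (hβ : β = LameNavier.lameBeta lam mu)
    (Ω : Set ℂ) (hΩ : IsOpen Ω) (hΩb : Bornology.IsBounded Ω)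
    (g : ℂ → ℂ) (hg : ContinuousOn g (closure Ω)) :
    (∀ z : ℂ, IntegrableOn (LameNavier.teodorescuIntegrand α β g z) Ω) ∧
    ContDiff ℝ 1 (LameNavier.teodorescu α β Ω g) ∧
    LameNavier.LameOpEqWeak α β Ω (LameNavier.teodorescu α β Ω g) g ∧
    (∀ z ∈ Ω,
      DifferentiableAt ℝ
        (LameNavier.dzbar (fun w => conj (LameNavier.teodorescu α β Ω g w))) z →
      DifferentiableAt ℝ (LameNavier.dz (LameNavier.teodorescu α β Ω g)) z →
      LameNavier.lameOp α β (LameNavier.teodorescu α β Ω g) z = g z) ∧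
    ContDiffOn ℝ ∞ (LameNavier.teodorescu α β Ω g) (closure Ω)ᶜ ∧
    (∀ z ∈ (closure Ω)ᶜ,
      LameNavier.lameOp α β (LameNavier.teodorescu α β Ω g) z = 0) := by
  obtain ⟨M, R, hG⟩ := LameNavier.exists_boundedDensity_indicator hΩ hΩb hg
  have hne : α ^ 2 - β ^ 2 ≠ 0 := by
    have h : α ^ 2 - β ^ 2 = -(mu * (2 * mu + lam)) := by
      rw [hα, hβ, LameNavier.lameAlpha, LameNavier.lameBeta]
      ring
    have : 0 < mu * (2 * mu + lam) := mul_pos hmu (by linarith)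
    rw [h]
    linarith
  refine ⟨LameNavier.integrableOn_teodorescuIntegrand hΩ hG,
    LameNavier.contDiff_one_teodorescu hΩ hG, LameNavier.lameOpEqWeak_teodorescu hΩ hG hne,
    fun z hz h1 h2 => ?_,
    fun z hz => (LameNavier.contDiffAt_teodorescu hΩ hG hz).contDiffWithinAt, fun z hz => ?_⟩
  · have heq : Ω.indicator g =ᶠ[𝓝 z] g :=
      eventually_of_mem (hΩ.mem_nhds hz) fun w hw => indicator_of_mem hw g
    have hc : ContinuousAt (Ω.indicator g) z :=
      ((hg.mono subset_closure).continuousAt (hΩ.mem_nhds hz)).congr heq.symm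
    rw [LameNavier.lameOp_teodorescu hΩ hG hne hc h1 h2, indicator_of_mem hz]
  · have heq : Ω.indicator g =ᶠ[𝓝 z] fun _ => 0 :=
      eventually_of_mem (isClosed_closure.isOpen_compl.mem_nhds hz) fun w hw =>
        indicator_of_notMem (fun h => hw (subset_closure h)) g
    have hs := LameNavier.contDiffAt_teodorescu (α := α) (β := β) hΩ hG hz
    rw [LameNavier.lameOp_teodorescu hΩ hG hne (continuousAt_const.congr heq.symm)
      (LameNavier.differentiableAt_dzbar (LameNavier.contDiffAt_conj hs))
      (LameNavier.differentiableAt_dz hs), heq.eq_of_nhds]
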